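/- Let $n\ge 0$, let $Q$ be a quiver of type $\mathbb{A}_{n+2}$ with vertices $1,\dots,n+2$ in linear order (so for each $1\le a\le n+1$ there is exactly one arrow between $a$ and $a+1$, in either direction, and no other arrows), let $\Bbbk$ be a field, and let $\operatorname{rep}Q$ be the category of finite dimensional representations of $Q$ over $\Bbbk$. **Maximal almost rigid representations.** A representation $T$ is *almost rigid* if it has no repeated indecomposable direct summands and, for all indecomposable direct summands $A,B$ of $T$, either $\operatorname{Ext}^1(A,B)=0$, or $\operatorname{Ext}^1(A,B)$ is one-dimensional and generated by the class of a short exact sequence $0\to B\to E\to A\to 0$ with $E$ indecomposable. It is *maximal almost rigid* if it is almost rigid and $T\oplus M$ is not almost rigid for every nonzero representation $M$. Let $\mathrm{mar}(Q)$ be the set of isomorphism classes of maximal almost rigid representations. For $T_1,T_2\in\mathrm{mar}(Q)$ say that $T_1$ *is covered by* $T_2$ if $T_1\cong M_1\oplus R$ and $T_2\cong M_2\oplus R$ with $M_1,M_2$ indecomposable, and there is a non-split short exact sequence $0\to M_1\to E\oplus E'\to M_2\to 0$ with $E,E'$ indecomposable direct summands of $R$. Let $\le$ be the reflexive transitive closure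 of this relation. **The Cambrian lattice of $Q$.** Let $P(Q)$ be a convex $(n+3)$-gon in the plane with vertices $0,1,\dots,n+2$ drawn in this order from left to right, no vertex lying in the convex hull of the others, such that $0$ and $n+2$ lie on a horizontal line $L$ and, for $1\le a\le n+1$, the vertex $a$ lies above $L$ if the arrow between $a$ and $a+1$ is $a\to a+1$, and below $L$ if it is $a\leftarrow a+1$. A triangulation of $P(Q)$ is a maximal set of pairwise non-crossing line segments between vertices (boundary edges included). Say that a triangulation $\mathcal T_1$ is covered by $\mathcal T_2$ if $\mathcal T_1\setminus\{\gamma_1\}=\mathcal T_2\setminus\{\gamma_2\}$ for some $\gamma_1\in\mathcal T_1$, $\gamma_2\in\mathcal T_2$ with $\gamma_1\ne\gamma_2$ and the slope of $\gamma_1$ smaller than the slope of $\gamma_2$. The type $\mathbb{A}$ Cambrian lattice of $Q$ is the set of triangulations of $P(Q)$ ordered by the reflexive transitive closure of this relation. **Theorem.** The relation $\le$ is a partial order on $\mathrm{mar}(Q)$, its covering relation is exactly the relation "$T_1$ is covered by $T_2$" defined above, and the poset $\mathrm{mar}(Q)$ is isomorphic to the type $\mathbb{A}$ Cambrian lattice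 of $Q$. -/

import Mathlib

open CategoryTheory CategoryTheory.Limits

universe u

/-! ### Quivers of type `A` and their representations -/

/-- The vertex set of the quiver of type `A_{n+2}` with orientation `up`. The vertices
`1, …, n + 2`, in linear order, are the elements `0, …, n + 1` of `Fin (n + 2)`. -/
def TypeAQuiver {n : ℕ} (_up : Fin (n + 1) → Bool) : Type := Fin (n + 2)

/-- The arrows: for every `a` there is exactly one arrow between the neighbouring vertices `a` and
`a + 1`, which points from `a` to `a + 1` if `up a` holds and from `a + 1` to `a` otherwise. -/
inductive TypeAQuiver.Arrow {n : ℕ} (up : Fin (n + 1) → Bool) :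
    Fin (n + 2) → Fin (n + 2) → Type
  | right (a : Fin (n + 1)) (h : up a = true) : TypeAQuiver.Arrow up a.castSucc a.succ
  | left (a : Fin (n + 1)) (h : up a = false) : TypeAQuiver.Arrow up a.succ a.castSucc

instance TypeAQuiver.instQuiver {n : ℕ} (up : Fin (n + 1) → Bool) :
    Quiver (TypeAQuiver up) where
  Hom i j := TypeAQuiver.Arrow up i j

/-- The category `rep Q` of finite dimensional representations over `k` of a quiver of
type `A`: functors from the free category on the quiver. -/
abbrev TypeARep (k : Type u) [Field k] {n : ℕ} (up : Fin (n + 1) → Bool) : Type (u + 1) :=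
  Paths (TypeAQuiver up) ⥤ FGModuleCat.{u} k

/-- The groups `Ext` exist in `rep Q`. -/
instance TypeARep.instHasExt (k : Type u) [Field k] {n : ℕ} (up : Fin (n + 1) → Bool) :
    HasExt.{u + 1} (TypeARep k up) :=
  HasExt.standard _

section Mar

variable {k : Type u} [Field k] {n : ℕ} {up : Fin (n + 1) → Bool}

/-- `X` is (isomorphic to) a direct summand of `T`. -/
def TypeARep.IsSummand (X T : TypeARep k up) : Prop :=
  ∃ Y : TypeARep k up, Nonempty (T ≅ X ⊞ Y)

/-- `T` is basic: it has no repeated (indecomposable) direct summand. -/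
def TypeARep.IsBasic (T : TypeARep k up) : Prop :=
  ∀ X : TypeARep k up, Indecomposable X → ¬ TypeARep.IsSummand (X ⊞ X) T

/-- `Ext(A, B)` is one-dimensional and is generated by the class of a short exact sequence
`0 ⟶ B ⟶ E ⟶ A ⟶ 0` whose middle term is indecomposable. -/
def TypeARep.ExtGeneratedByIndecomposable (A B : TypeARep k up) : Prop :=
  Module.finrank k (Abelian.Ext A B 1) = 1 ∧
    ∃ (E : TypeARep k up) (f : B ⟶ E) (g : E ⟶ A) (w : f ≫ g = 0)
      (h : (ShortComplex.mk f g w).ShortExact),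
      Indecomposable E ∧ Submodule.span k {(h.extClass : Abelian.Ext A B 1)} = ⊤

/-- Almost rigid representations. -/
def TypeARep.IsAlmostRigid (T : TypeARep k up) : Prop :=
  TypeARep.IsBasic T ∧
    ∀ A B : TypeARep k up, Indecomposable A → Indecomposable B →
      TypeARep.IsSummand A T → TypeARep.IsSummand B T →
        Subsingleton (Abelian.Ext A B 1) ∨ TypeARep.ExtGeneratedByIndecomposable A B

/-- Maximal almost rigid representations. -/
def TypeARep.IsMaximalAlmostRigid (T : TypeARep k up) : Prop :=
  TypeARep.IsAlmostRigid T ∧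
    ∀ M : TypeARep k up, ¬ IsZero M → ¬ TypeARep.IsAlmostRigid (T ⊞ M)

variable (k up) in
/-- The set `mar(Q)` of isomorphism classes of maximal almost rigid representations. -/
def Mar : Type (u + 1) :=
  Quotient ((isIsomorphicSetoid (TypeARep k up)).comap
    (Subtype.val : {T : TypeARep k up // TypeARep.IsMaximalAlmostRigid T} → TypeARep k up))

/-- The isomorphism class of a maximal almost rigid representation. -/
def Mar.mk (T : TypeARep k up) (hT : TypeARep.IsMaximalAlmostRigid T) : Mar k up :=
  Quotient.mk _ ⟨T, hT⟩

/-- The relation `T₁` is covered by `T₂`, for representations: `T₁ ≅ M₁ ⊕ R` and `T₂ ≅ M₂ ⊕ R`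
with `M₁`, `M₂` indecomposable, and there is a non-split short exact sequence
`0 ⟶ M₁ ⟶ E ⊕ E' ⟶ M₂ ⟶ 0` with `E`, `E'` indecomposable summands of `R`. -/
def TypeARep.CoveredBy (T₁ T₂ : TypeARep k up) : Prop :=
  ∃ M₁ M₂ R E E' : TypeARep k up,
    Indecomposable M₁ ∧ Indecomposable M₂ ∧
    Nonempty (T₁ ≅ M₁ ⊞ R) ∧ Nonempty (T₂ ≅ M₂ ⊞ R) ∧
    Indecomposable E ∧ Indecomposable E' ∧
    TypeARep.IsSummand E R ∧ TypeARep.IsSummand E' R ∧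
    ∃ (f : M₁ ⟶ E ⊞ E') (g : E ⊞ E' ⟶ M₂) (w : f ≫ g = 0),
      (ShortComplex.mk f g w).ShortExact ∧ IsEmpty (ShortComplex.mk f g w).Splitting

/-- The relation `T₁` is covered by `T₂` on `mar(Q)`. -/
def Mar.CoveredBy (t₁ t₂ : Mar k up) : Prop :=
  ∃ (T₁ T₂ : TypeARep k up) (h₁ : TypeARep.IsMaximalAlmostRigid T₁)
    (h₂ : TypeARep.IsMaximalAlmostRigid T₂),
    t₁ = Mar.mk T₁ h₁ ∧ t₂ = Mar.mk T₂ h₂ ∧ TypeARep.CoveredBy T₁ T₂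

/-- The order on `mar(Q)` generated by the relation `Mar.CoveredBy`. -/
instance Mar.instPreorder : Preorder (Mar k up) where
  le := Relation.ReflTransGen Mar.CoveredBy
  le_refl _ := Relation.ReflTransGen.refl
  le_trans _ _ _ h h' := h.trans h'

end Mar

/-! ### The polygon of a quiver of type `A` and its triangulations -/

/-- A drawing in the plane of the convex `(n + 3)`-gon `P(Q)` with vertices `0, …, n + 2`. -/
structure PolygonDrawing {n : ℕ} (up : Fin (n + 1) → Bool) where
  /-- the position of each vertex -/
  pt : Fin (n + 3) → ℝ × ℝ
  /-- the vertices are drawn in order from left to right -/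
  strictMono_fst : StrictMono fun i => (pt i).1
  /-- the first and the last vertex lie on the same horizontal line -/
  snd_last : (pt (Fin.last (n + 2))).2 = (pt 0).2
  /-- the upper-barred vertices lie above that line -/
  above : ∀ a : Fin (n + 1), up a = true → (pt 0).2 < (pt a.castSucc.succ).2
  /-- the lower-barred vertices lie below that line -/
  below : ∀ a : Fin (n + 1), up a = false → (pt a.castSucc.succ).2 < (pt 0).2
  /-- the points are the vertices of a convex polygon: none lies in the convex hull of others -/
  convexIndependent : ConvexIndependent ℝ pt

section Polygon

variable {n : ℕ} {up : Fin (n + 1) → Bool}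

/-- The line segments (boundary edges and diagonals) between two vertices `i < j` of a polygon with
vertices `0, …, n + 2`. -/
abbrev PolygonSegment (n : ℕ) : Type :=
  {p : Fin (n + 3) × Fin (n + 3) // p.1 < p.2}

/-- The slope of the line segment between `i` and `j`. -/
noncomputable def PolygonDrawing.slope (P : PolygonDrawing up) (γ : PolygonSegment n) : ℝ :=
  ((P.pt γ.1.2).2 - (P.pt γ.1.1).2) / ((P.pt γ.1.2).1 - (P.pt γ.1.1).1)

/-- Two different line segments cross if they have a common interior point. -/
def PolygonDrawing.Cross (P : PolygonDrawing up) (γ δ : PolygonSegment n) : Prop :=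
  γ ≠ δ ∧
    (openSegment ℝ (P.pt γ.1.1) (P.pt γ.1.2) ∩ openSegment ℝ (P.pt δ.1.1) (P.pt δ.1.2)).Nonempty

/-- A set of pairwise non-crossing line segments. -/
def PolygonDrawing.Noncrossing (P : PolygonDrawing up) (S : Set (PolygonSegment n)) : Prop :=
  ∀ γ ∈ S, ∀ δ ∈ S, ¬ P.Cross γ δ

/-- The triangulations of the polygon, including the boundary edges: the maximal sets of pairwise
non-crossing line segments. -/
def PolygonDrawing.Triangulation (P : PolygonDrawing up) : Type :=
  {S : Set (PolygonSegment n) // Maximal P.Noncrossing S}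

/-- `T₁` is covered by `T₂` if `T₂` arises from `T₁` by replacing one line segment by another one of
larger slope. -/
def PolygonDrawing.Triangulation.CoveredBy {P : PolygonDrawing up}
    (T₁ T₂ : P.Triangulation) : Prop :=
  ∃ γ₁ ∈ T₁.1, ∃ γ₂ ∈ T₂.1, γ₁ ≠ γ₂ ∧ T₁.1 \ {γ₁} = T₂.1 \ {γ₂} ∧ P.slope γ₁ < P.slope γ₂

/-- The Cambrian lattice: the order on the set of triangulations generated by the covering
relation `PolygonDrawing.Triangulation.CoveredBy`. -/
instance PolygonDrawing.Triangulation.instPreorder (P : PolygonDrawing up) :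
    Preorder P.Triangulation where
  le := Relation.ReflTransGen PolygonDrawing.Triangulation.CoveredBy
  le_refl _ := Relation.ReflTransGen.refl
  le_trans _ _ _ h h' := h.trans h'

end Polygon

/-!
Every representation of a quiver of type `A` is a direct sum of thin representations supported on
intervals, and the interval from `i + 1` to `j` corresponds to the line segment between the vertices
`i < j` of the polygon. Therefore basic representations are determined by sets of segments. For two
segments `γ` and `δ`, the group `Ext¹(δ, γ)` is nonzero in exactly two cases: if `γ` and `δ` cross
and `γ` has the smaller slope, where the extension has a decomposable middle term, given by two
sides of the quadrilateral with diagonals `γ` and `δ`; or if they share an end point such that the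
middle term is the indecomposable representation of a third segment. Only the first case is
incompatible with being almost rigid, hence maximal almost rigid representations correspond to
triangulations, and their covering relation to flips which increase the slope.

A flip `γ₁ ↦ γ₂` does not destroy upward crossings: a segment which crosses `γ₁` with smaller slope
crosses `γ₂` or one of the sides of the quadrilateral in the same way. Thus a segment which is
removed by a flip cannot reappear, which shows that the order is antisymmetric and that flips
are covers.
-/

section AbelianCategory

universe w v u'

variable {C : Type u'} [Category.{v} C] [Abelian C]

open HomologicalComplex in
lemma exists_epi_of_quasiIso_single {X : C} {K : CochainComplex C ℤ} [K.IsStrictlyLE 0]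
    (π : K ⟶ (single C (ComplexShape.up ℤ) 0).obj X) [QuasiIso π] :
    ∃ (p : K.X 0 ⟶ X) (ι : (single C (ComplexShape.up ℤ) 0).obj (K.X 0) ⟶ K),
      Epi p ∧ ι ≫ π = (single C (ComplexShape.up ℤ) 0).map p := by
  have hz := K.isZero_of_isStrictlyLE 0 1 (by simp)
  let ε := K.iCyclesIso 0 1 (by simp) (hz.eq_of_tgt _ _)
  let p := ε.inv ≫ K.homologyπ 0 ≫ homologyMap π 0 ≫ (singleObjHomologySelfIso _ _ _).hom
  have hp : π.f 0 = p ≫ (singleObjXSelf (ComplexShape.up ℤ) 0 X).inv := by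
    rw [← cancel_epi ε.hom]
    dsimp only [p, ε]
    rw [Category.assoc, Category.assoc, Category.assoc, Iso.hom_inv_id_assoc, iCyclesIso_hom,
      homologyπ_naturality_assoc, homologyπ_singleObjHomologySelfIso_hom_assoc,
      ← singleObjCyclesSelfIso_inv_iCycles, Iso.hom_inv_id_assoc, ← cyclesMap_i]
  let ι := mkHomFromSingle (K := K) (𝟙 (K.X 0)) (by
    rintro _ rfl
    exact (K.isZero_of_isStrictlyLE 0 _ (by simp)).eq_of_tgt _ _)
  refine ⟨p, ι, by dsimp only [p]; infer_instance, from_single_hom_ext ?_⟩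
  rw [comp_f, mkHomFromSingle_f, Category.assoc, Category.id_comp, hp, single_map_f_self]

open DerivedCategory in
lemma exists_epi_comp_eq_zero_of_neg [HasDerivedCategory.{w} C] {X Y : C} {m : ℤ} (hm : m < 0)
    (f : Q.obj ((HomologicalComplex.single C (ComplexShape.up ℤ) 0).obj X) ⟶
      Q.obj ((HomologicalComplex.single C (ComplexShape.up ℤ) m).obj Y)) :
    ∃ (Z : C) (p : Z ⟶ X), Epi p ∧
      Q.map ((HomologicalComplex.single C (ComplexShape.up ℤ) 0).map p) ≫ f = 0 := by
  have : CochainComplex.IsStrictlyLE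
      ((HomologicalComplex.single C (ComplexShape.up ℤ) 0).obj X) 0 :=
    inferInstanceAs (CochainComplex.IsStrictlyLE ((CochainComplex.singleFunctor C 0).obj X) 0)
  obtain ⟨K, _, π, hπ, g, rfl⟩ := right_fac_of_isStrictlyLE f 0
  have : QuasiIso π := by
    rwa [← isIso_Q_map_iff_quasiIso]
  obtain ⟨p, ι, hp, hι⟩ := exists_epi_of_quasiIso_single π
  have hg : ι ≫ g = 0 := HomologicalComplex.from_single_hom_ext
    ((HomologicalComplex.isZero_single_obj_X _ _ _ _ (by lia)).eq_of_tgt _ _)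
  refine ⟨_, p, hp, ?_⟩
  rw [← hι, Q.map_comp, Category.assoc, IsIso.hom_inv_id_assoc, ← Q.map_comp, hg, Q.map_zero]

section Ext

variable [HasExt.{w} C]

open Abelian Abelian.Ext

open DerivedCategory in
lemma exists_epi_mk₀_comp_eq_zero {X Y : C} {n : ℕ} (e : Ext X Y (n + 1)) :
    ∃ (Z : C) (p : Z ⟶ X), Epi p ∧ (mk₀ p).comp e (zero_add _) = 0 := by
  let := HasDerivedCategory.standard C
  let s := ((singleFunctors C).shiftIso (n + 1) (-(n + 1)) 0 (by lia)).hom.app Y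
  obtain ⟨Z, p, hp, h⟩ := exists_epi_comp_eq_zero_of_neg (X := X) (Y := Y)
    (m := -(n + 1)) (by lia) (e.hom ≫ s)
  have hs : ((singleFunctor C 0).map p ≫ e.hom) ≫ s = 0 := (Category.assoc _ _ _).trans h
  refine ⟨Z, p, hp, ?_⟩
  ext
  rw [comp_hom, mk₀_hom, ShiftedHom.mk₀_comp, zero_hom, ← cancel_mono s, Limits.zero_comp]
  exact hs

lemma subsingleton_ext_one_of_forall_extends (X Y : C)
    (H : ∀ (K Z : C) (f : K ⟶ Z) (g : Z ⟶ X) (w : f ≫ g = 0),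
      (ShortComplex.mk f g w).ShortExact → ∀ h : K ⟶ Y, ∃ h' : Z ⟶ Y, f ≫ h' = h) :
    Subsingleton (Ext X Y 1) := by
  refine subsingleton_of_forall_eq 0 fun e ↦ ?_
  obtain ⟨Z, p, hp, he⟩ := exists_epi_mk₀_comp_eq_zero (n := 0) e
  have hS : (ShortComplex.mk (kernel.ι p) p (kernel.condition p)).ShortExact :=
    { exact := ShortComplex.exact_of_f_is_kernel _ (kernelIsKernel p) }
  obtain ⟨x, rfl⟩ := contravariant_sequence_exact₃ hS _ e he (n₀ := 0) rfl
  obtain ⟨h, rfl⟩ := (mk₀_bijective _ _).2 x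
  obtain ⟨h', rfl⟩ := H _ _ _ _ _ hS h
  have hzero := hS.extClass_comp_assoc (mk₀ h') (n' := 1) (h := rfl)
  rwa [mk₀_comp_mk₀] at hzero

lemma subsingleton_ext_of_iso {X X' Y Y' : C} (eX : X ≅ X') (eY : Y ≅ Y') (n : ℕ)
    [Subsingleton (Ext X' Y' n)] : Subsingleton (Ext X Y n) := by
  refine subsingleton_of_forall_eq 0 fun e ↦ ?_
  have h : (mk₀ eX.inv).comp (e.comp (mk₀ eY.hom) (add_zero n)) (zero_add n) = 0 :=
    Subsingleton.elim _ _
  simpa using congrArg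
    (fun x ↦ (mk₀ eX.hom).comp (x.comp (mk₀ eY.inv) (add_zero n)) (zero_add n)) h

lemma nonempty_splitting_of_extClass_eq_zero {S : ShortComplex C} (hS : S.ShortExact)
    (h : hS.extClass = 0) : Nonempty S.Splitting := by
  obtain ⟨x, hx⟩ := contravariant_sequence_exact₁ hS S.X₁ (mk₀ (𝟙 _)) (n₁ := 1) rfl
    (by rw [h, Ext.zero_comp])
  obtain ⟨r, rfl⟩ := (mk₀_bijective _ _).2 x
  rw [mk₀_comp_mk₀] at hx
  exact ⟨.ofExactOfRetraction S hS.exact r ((mk₀_bijective _ _).1 hx) hS.epi_g⟩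

lemma nonempty_splitting_of_subsingleton_ext {S : ShortComplex C} (hS : S.ShortExact)
    [Subsingleton (Ext S.X₃ S.X₁ 1)] : Nonempty S.Splitting :=
  nonempty_splitting_of_extClass_eq_zero hS (Subsingleton.elim _ _)

end Ext

lemma nonempty_iso_biprod_cokernel {X T : C} (h : Retract X T) :
    Nonempty (T ≅ X ⊞ cokernel h.i) :=
  ⟨(ShortComplex.Splitting.ofExactOfRetraction (.mk h.i (cokernel.π h.i) (cokernel.condition _))
    (ShortComplex.exact_of_g_is_cokernel _ (cokernelIsCokernel _)) h.r h.retract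
    inferInstance).isoBinaryBiproduct⟩

lemma nonempty_iso_of_retract_indecomposable {X T : C} (h : Retract X T) (hX : ¬ IsZero X)
    (hT : Indecomposable T) : Nonempty (X ≅ T) := by
  obtain ⟨e⟩ := nonempty_iso_biprod_cokernel h
  have : Epi h.i :=
    (Preadditive.epi_iff_isZero_cokernel h.i).2 ((hT.2 _ _ e).resolve_left hX)
  have : IsIso h.i := isIso_of_mono_of_epi h.i
  exact ⟨asIso h.i⟩

lemma nonempty_retract_of_comp_eq_zero {W Y Z : C} (h : Retract W (Y ⊞ Z))
    (hY : ∀ (i : W ⟶ Y) (r : Y ⟶ W), i ≫ r = 0) : Nonempty (Retract W Z) := by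
  refine ⟨⟨h.i ≫ biprod.snd, biprod.inr ≫ h.r, ?_⟩⟩
  have hsum : h.i ≫ (biprod.fst ≫ biprod.inl + biprod.snd ≫ biprod.inr) ≫ h.r = 𝟙 W := by
    rw [biprod.total, Category.id_comp, h.retract]
  have hzero : h.i ≫ biprod.fst ≫ biprod.inl ≫ h.r = 0 := by
    simpa only [Category.assoc] using hY (h.i ≫ biprod.fst) (biprod.inl ≫ h.r)
  simpa only [Preadditive.add_comp, Preadditive.comp_add, Category.assoc, hzero, zero_add]
    using hsum

section Brick

variable (k : Type*) [Field k] [Linear k C]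

/-- Bricks over `k`: the nonzero objects of a `k`-linear category all of whose endomorphisms are
scalars. -/
def IsBrick (X : C) : Prop :=
  ¬ IsZero X ∧ ∀ f : X ⟶ X, ∃ c : k, f = c • 𝟙 X

variable {k} {X Y Z T : C}

namespace IsBrick

lemma of_iso (hX : IsBrick k X) (e : X ≅ Y) : IsBrick k Y := by
  refine ⟨fun h ↦ hX.1 (h.of_iso e), fun f ↦ ?_⟩
  obtain ⟨c, hc⟩ := hX.2 (e.hom ≫ f ≫ e.inv)
  refine ⟨c, ?_⟩
  simpa using congrArg (fun g ↦ e.inv ≫ g ≫ e.hom) hc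

lemma indecomposable (hX : IsBrick k X) : Indecomposable X := by
  refine ⟨hX.1, fun Y Z e ↦ ?_⟩
  obtain ⟨c, hc⟩ := hX.2 (e.hom ≫ biprod.fst ≫ biprod.inl ≫ e.inv)
  have hproj : (biprod.fst ≫ biprod.inl : Y ⊞ Z ⟶ Y ⊞ Z) = c • 𝟙 _ := by
    simpa using congrArg (fun f ↦ e.inv ≫ f ≫ e.hom) hc
  have hY : 𝟙 Y = c • 𝟙 Y := by
    simpa using congrArg (fun f ↦ biprod.inl ≫ f ≫ biprod.fst) hproj
  have hZ : 0 = c • 𝟙 Z := by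
    simpa using congrArg (fun f ↦ biprod.inr ≫ f ≫ biprod.snd) hproj
  rw [IsZero.iff_id_eq_zero, IsZero.iff_id_eq_zero]
  refine (smul_eq_zero.1 hZ.symm).imp_left fun hc0 ↦ ?_
  rw [hY, hc0, zero_smul]

lemma comp_eq_zero (hX : IsBrick k X) (hT : IsEmpty (Retract X T)) (i : X ⟶ T) (r : T ⟶ X) :
    i ≫ r = 0 := by
  obtain ⟨c, hc⟩ := hX.2 (i ≫ r)
  by_contra hne
  have hc0 : c ≠ 0 := by
    rintro rfl
    exact hne (by rw [hc, zero_smul])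
  refine hT.false ⟨i, c⁻¹ • r, ?_⟩
  rw [Linear.comp_smul, hc, smul_smul, inv_mul_cancel₀ hc0, one_smul]

lemma nonempty_retract_of_retract_biprod (hX : IsBrick k X) (h : Retract X (Y ⊞ Z)) :
    Nonempty (Retract X Y) ∨ Nonempty (Retract X Z) := by
  refine or_iff_not_imp_left.2 fun hY ↦ ?_
  exact nonempty_retract_of_comp_eq_zero h (hX.comp_eq_zero (not_nonempty_iff.1 hY))

lemma nonempty_retract_of_retract_biprod_self (hX : IsBrick k X) (hY : IsEmpty (Retract X Y))
    (h : Retract (X ⊞ X) (Y ⊞ Z)) : Nonempty (Retract (X ⊞ X) Z) := by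
  refine nonempty_retract_of_comp_eq_zero h fun i r ↦ ?_
  have hzero (a : X ⟶ X ⊞ X) (b : X ⊞ X ⟶ X) : a ≫ i ≫ r ≫ b = 0 := by
    simpa only [Category.assoc] using hX.comp_eq_zero hY (a ≫ i) (r ≫ b)
  ext <;> simp only [Category.assoc, hzero, zero_comp, comp_zero]

lemma isEmpty_retract_biprod_self (hX : IsBrick k X) (hZ : IsEmpty (Retract X Z)) :
    IsEmpty (Retract (X ⊞ X) (X ⊞ Z)) := by
  refine ⟨fun h ↦ ?_⟩
  have hXX : ¬ IsZero (X ⊞ X) := fun h0 ↦ hX.1 ((biprod_isZero_iff X X).1 h0).1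
  obtain ⟨h'⟩ := hX.nonempty_retract_of_retract_biprod_self hZ
    (h.trans (.ofIso (biprod.braiding _ _)))
  obtain ⟨e⟩ := nonempty_iso_of_retract_indecomposable h' hXX hX.indecomposable
  exact (hX.indecomposable.2 _ _ e.symm).elim hX.1 hX.1

end IsBrick

section Ext

variable [HasExt.{w} C] {S : ShortComplex C}

open Abelian Abelian.Ext

lemma exists_smul_extClass_eq (hS : S.ShortExact) (hX₁ : IsBrick k S.X₁)
    [Subsingleton (Ext S.X₂ S.X₁ 1)] (e : Ext S.X₃ S.X₁ 1) : ∃ c : k, c • hS.extClass = e := by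
  obtain ⟨x, rfl⟩ := contravariant_sequence_exact₃ hS _ e (Subsingleton.elim _ _) (n₀ := 0) rfl
  obtain ⟨f, rfl⟩ := (mk₀_bijective _ _).2 x
  obtain ⟨c, rfl⟩ := hX₁.2 f
  exact ⟨c, by rw [mk₀_smul, comp_smul, comp_mk₀_id]⟩

lemma finrank_ext_eq_one (hS : S.ShortExact) (hsplit : IsEmpty S.Splitting)
    (hX₁ : IsBrick k S.X₁) [Subsingleton (Ext S.X₂ S.X₁ 1)] :
    Module.finrank k (Ext S.X₃ S.X₁ 1) = 1 :=
  (finrank_eq_one_iff_of_nonzero' hS.extClass fun h ↦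
    hsplit.false (nonempty_splitting_of_extClass_eq_zero hS h).some).2
    (exists_smul_extClass_eq hS hX₁)

lemma span_extClass_eq_top (hS : S.ShortExact) (hX₁ : IsBrick k S.X₁)
    [Subsingleton (Ext S.X₂ S.X₁ 1)] : Submodule.span k {hS.extClass} = ⊤ :=
  Submodule.eq_top_iff'.2 fun e ↦ Submodule.mem_span_singleton.2 (exists_smul_extClass_eq hS hX₁ e)

end Ext

end Brick

end AbelianCategory

namespace TypeARep

variable {k : Type u} [Field k] {n : ℕ} {up : Fin (n + 1) → Bool}

/-- The vertex space of a representation. -/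
def Space (V : TypeARep k up) (v : Fin (n + 2)) : Type u :=
  (V.obj (show Paths (TypeAQuiver up) from v) : FGModuleCat k).obj

variable (V W U : TypeARep k up)

noncomputable instance (v : Fin (n + 2)) : AddCommGroup (V.Space v) :=
  inferInstanceAs (AddCommGroup (V.obj (show Paths (TypeAQuiver up) from v)).obj)

noncomputable instance (v : Fin (n + 2)) : Module k (V.Space v) :=
  inferInstanceAs (Module k (V.obj (show Paths (TypeAQuiver up) from v)).obj)

instance (v : Fin (n + 2)) : FiniteDimensional k (V.Space v) :=
  inferInstanceAs (Module.Finite k (V.obj (show Paths (TypeAQuiver up) from v)))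

/-- An arrow of the quiver as a path. -/
def path {s t : Fin (n + 2)} (e : TypeAQuiver.Arrow up s t) :
    (show Paths (TypeAQuiver up) from s) ⟶ (show Paths (TypeAQuiver up) from t) :=
  Quiver.Hom.toPath (V := TypeAQuiver up) (a := s) (b := t) e

/-- The linear map of a representation at an arrow. -/
def arr {s t : Fin (n + 2)} (e : TypeAQuiver.Arrow up s t) : V.Space s →ₗ[k] V.Space t :=
  (V.map (path e)).hom.hom

variable {V W U}

/-- The components of a morphism of representations. -/
def app (f : V ⟶ W) (v : Fin (n + 2)) : V.Space v →ₗ[k] W.Space v :=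
  (NatTrans.app f (show Paths (TypeAQuiver up) from v)).hom.hom

lemma app_arr (f : V ⟶ W) {s t : Fin (n + 2)} (e : TypeAQuiver.Arrow up s t) (x : V.Space s) :
    app f t (V.arr e x) = W.arr e (app f s x) :=
  LinearMap.congr_fun (congrArg (fun g ↦ g.hom.hom) (f.naturality (path e))) x

lemma hom_ext {f g : V ⟶ W} (h : ∀ v x, app f v x = app g v x) : f = g :=
  NatTrans.ext (funext fun v ↦ FGModuleCat.hom_ext (LinearMap.ext (h v)))

@[simp] lemma app_id (v : Fin (n + 2)) (x : V.Space v) : app (𝟙 V) v x = x := rfl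

@[simp] lemma app_comp (f : V ⟶ W) (g : W ⟶ U) (v : Fin (n + 2)) (x : V.Space v) :
    app (f ≫ g) v x = app g v (app f v x) := rfl

@[simp] lemma app_zero (v : Fin (n + 2)) (x : V.Space v) : app (0 : V ⟶ W) v x = 0 := rfl

@[simp] lemma app_smul (c : k) (f : V ⟶ W) (v : Fin (n + 2)) (x : V.Space v) :
    app (c • f) v x = c • app f v x := rfl

/-- A morphism of representations is given by linear maps which commute with the arrows. -/
def ofApp (f : ∀ v, V.Space v →ₗ[k] W.Space v)
    (hf : ∀ (s t : Fin (n + 2)) (e : TypeAQuiver.Arrow up s t) (x : V.Space s),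
      f t (V.arr e x) = W.arr e (f s x)) : V ⟶ W where
  app v := ObjectProperty.homMk (ModuleCat.ofHom (f v))
  naturality {X Y} p := by
    induction p using Paths.induction_fixed_source with
    | id => rw [V.map_id, W.map_id, Category.id_comp, Category.comp_id]
    | comp p q ih =>
      have hq : V.map ((Paths.of (TypeAQuiver up)).map q) ≫
          ObjectProperty.homMk (ModuleCat.ofHom (f _)) =
          ObjectProperty.homMk (ModuleCat.ofHom (f _)) ≫
            W.map ((Paths.of (TypeAQuiver up)).map q) :=
        FGModuleCat.hom_ext (LinearMap.ext (hf _ _ q))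
      rw [V.map_comp, W.map_comp, Category.assoc, hq, ← Category.assoc, ih, Category.assoc]

@[simp] lemma app_ofApp (f : ∀ v, V.Space v →ₗ[k] W.Space v) (hf) (v : Fin (n + 2)) :
    app (ofApp f hf) v = f v := rfl

/-- The representation with given vertex spaces and linear maps at the arrows. -/
def ofSpaces (X : Fin (n + 2) → FGModuleCat.{u} k)
    (m : ∀ {s t : Fin (n + 2)}, TypeAQuiver.Arrow up s t → (X s →ₗ[k] X t)) : TypeARep k up :=
  Paths.lift (V := TypeAQuiver up)
    { obj := X
      map := fun {s t} e ↦ ObjectProperty.homMk (ModuleCat.ofHom (m (s := s) (t := t) e)) }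

lemma arr_ofSpaces (X : Fin (n + 2) → FGModuleCat.{u} k)
    (m : ∀ {s t : Fin (n + 2)}, TypeAQuiver.Arrow up s t → (X s →ₗ[k] X t))
    {s t : Fin (n + 2)} (e : TypeAQuiver.Arrow up s t) (x : X s) :
    (ofSpaces X m).arr e x = m e x := by
  have h := Paths.lift_toPath (V := TypeAQuiver up) (C := FGModuleCat.{u} k)
    { obj := X
      map := fun {s t} e ↦ ObjectProperty.homMk (ModuleCat.ofHom (m (s := s) (t := t) e)) } e
  exact LinearMap.congr_fun (congrArg (fun g ↦ g.hom.hom) h) x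

variable (k up) in
/-- Evaluation at a vertex, as a functor to modules. -/
abbrev evalModule (v : Fin (n + 2)) : TypeARep k up ⥤ ModuleCat.{u} k :=
  (evaluation (Paths (TypeAQuiver up)) (FGModuleCat.{u} k)).obj
      (show Paths (TypeAQuiver up) from v) ⋙
    forget₂ (FGModuleCat.{u} k) (ModuleCat.{u} k)

instance (v : Fin (n + 2)) : PreservesFiniteLimits (evalModule k up v) :=
  have : PreservesFiniteLimits
      ((evaluation (Paths (TypeAQuiver up)) (FGModuleCat.{u} k)).obj
        (show Paths (TypeAQuiver up) from v)) :=
    ⟨fun _ _ _ ↦ inferInstance⟩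
  comp_preservesFiniteLimits _ _

instance (v : Fin (n + 2)) : PreservesFiniteColimits (evalModule k up v) :=
  have : PreservesFiniteColimits
      ((evaluation (Paths (TypeAQuiver up)) (FGModuleCat.{u} k)).obj
        (show Paths (TypeAQuiver up) from v)) :=
    ⟨fun _ _ _ ↦ inferInstance⟩
  comp_preservesFiniteColimits _ _

section ShortExact

variable {f : V ⟶ W} {g : W ⟶ U} {w : f ≫ g = 0}

lemma injective_of_shortExact (h : (ShortComplex.mk f g w).ShortExact) (v : Fin (n + 2)) :
    Function.Injective (app f v) :=
  (h.map_of_exact (evalModule k up v)).moduleCat_injective_f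

lemma surjective_of_shortExact (h : (ShortComplex.mk f g w).ShortExact) (v : Fin (n + 2)) :
    Function.Surjective (app g v) :=
  (h.map_of_exact (evalModule k up v)).moduleCat_surjective_g

lemma exact_of_shortExact (h : (ShortComplex.mk f g w).ShortExact) (v : Fin (n + 2)) :
    Function.Exact (app f v) (app g v) :=
  (ShortComplex.ShortExact.moduleCat_exact_iff_function_exact _).1
    (h.map_of_exact (evalModule k up v)).exact

lemma finrank_of_shortExact (h : (ShortComplex.mk f g w).ShortExact) (v : Fin (n + 2)) :
    Module.finrank k (W.Space v) = Module.finrank k (V.Space v) + Module.finrank k (U.Space v) := by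
  rw [← (app g v).finrank_range_add_finrank_ker, (exact_of_shortExact h v).linearMap_ker_eq,
    LinearMap.range_eq_top.2 (surjective_of_shortExact h v), finrank_top,
    LinearMap.finrank_range_of_inj (injective_of_shortExact h v), add_comm]

lemma mono_of_injective (h : ∀ v, Function.Injective (app f v)) : Mono f :=
  ⟨fun a b hab ↦ hom_ext fun v x ↦ h v (by rw [← app_comp, hab, app_comp])⟩

lemma epi_of_surjective (h : ∀ v, Function.Surjective (app f v)) : Epi f :=
  ⟨fun a b hab ↦ hom_ext fun v x ↦ by
    obtain ⟨y, rfl⟩ := h v x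
    rw [← app_comp, hab, app_comp]⟩

lemma shortExact_of_app (hf : ∀ v, Function.Injective (app f v))
    (hg : ∀ v, Function.Surjective (app g v)) (h : ∀ v, Function.Exact (app f v) (app g v)) :
    (ShortComplex.mk f g w).ShortExact := by
  refine ShortComplex.ShortExact.mk' ?_ (mono_of_injective hf) (epi_of_surjective hg)
  rw [ShortComplex.exact_iff_isZero_homology, Functor.isZero_iff]
  intro v
  have hv : ((ShortComplex.mk f g w).map (evalModule k up v)).Exact :=
    (ShortComplex.ShortExact.moduleCat_exact_iff_function_exact _).2 (h v)
  have hzero := ((ShortComplex.exact_iff_isZero_homology _).1 hv).of_iso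
    ((ShortComplex.mk f g w).mapHomologyIso (evalModule k up v)).symm
  rw [IsZero.iff_id_eq_zero] at hzero ⊢
  exact (forget₂ (FGModuleCat.{u} k) (ModuleCat.{u} k)).map_injective hzero

end ShortExact

lemma finrank_eq_of_iso (e : V ≅ W) (v : Fin (n + 2)) :
    Module.finrank k (V.Space v) = Module.finrank k (W.Space v) :=
  (LinearEquiv.ofLinearMap (app e.hom v) (app e.inv v)
    (LinearMap.ext fun x ↦ by rw [LinearMap.comp_apply, ← app_comp, e.inv_hom_id]; rfl)
    (LinearMap.ext fun x ↦ by rw [LinearMap.comp_apply, ← app_comp, e.hom_inv_id]; rfl)).finrank_eq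

lemma isZero_iff_subsingleton : IsZero V ↔ ∀ v, Subsingleton (V.Space v) := by
  rw [IsZero.iff_id_eq_zero]
  refine ⟨fun h v ↦ subsingleton_of_forall_eq 0 fun x ↦ ?_,
    fun h ↦ hom_ext fun v x ↦ (h v).elim _ _⟩
  rw [← app_id v x, h, app_zero]

end TypeARep

namespace TypeARep

variable {k : Type u} [Field k] {n : ℕ} {up : Fin (n + 1) → Bool}

lemma nonempty_arrow_or (up : Fin (n + 1) → Bool) (a : Fin (n + 1)) :
    Nonempty (TypeAQuiver.Arrow up a.castSucc a.succ) ∨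
      Nonempty (TypeAQuiver.Arrow up a.succ a.castSucc) := by
  cases h : up a
  · exact .inr ⟨.left a h⟩
  · exact .inl ⟨.right a h⟩

open Classical in
/-- The line `k` if `p` holds and `0` otherwise, as a subspace of `k`: the vertex space of a thin
representation. -/
noncomputable def stalk (k : Type u) [Field k] (p : Prop) : Submodule k k := if p then ⊤ else ⊥

lemma mem_stalk {p : Prop} {c : k} : c ∈ stalk k p ↔ (¬ p → c = 0) := by
  by_cases h : p <;> simp [stalk, h]

open Classical in
/-- The map between stalks which is the identity of `k` if both are `k`, and `0` otherwise: the map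
of a thin representation at an arrow. -/
noncomputable def stalkMap (p q : Prop) : stalk k p →ₗ[k] stalk k q where
  toFun x := ⟨if q then x else 0, mem_stalk.2 fun h ↦ if_neg h⟩
  map_add' x y := by ext; by_cases h : q <;> simp [h]
  map_smul' c x := by ext; by_cases h : q <;> simp [h]

variable (k up) in
/-- The thin representation with support `S`: it is `k` at the vertices in `S`, with identity maps
between them, and `0` elsewhere. -/
noncomputable def thin (S : Set (Fin (n + 2))) : TypeARep k up :=
  ofSpaces (fun v ↦ FGModuleCat.of k (stalk k (v ∈ S))) fun {s t} _ ↦ stalkMap (s ∈ S) (t ∈ S)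

variable {S S' : Set (Fin (n + 2))} {V : TypeARep k up} {v : Fin (n + 2)}

/-- The coordinate on the vertex spaces of a thin representation. -/
noncomputable def val (v : Fin (n + 2)) : (thin k up S).Space v →ₗ[k] k :=
  (stalk k (v ∈ S)).subtype

open Classical in
/-- The basis vector of the vertex space of a thin representation, which is `0` by convention at the
vertices outside the support. -/
noncomputable def unit (v : Fin (n + 2)) : (thin k up S).Space v :=
  (⟨if v ∈ S then 1 else 0, mem_stalk.2 fun h ↦ if_neg h⟩ : stalk k (v ∈ S))

lemma val_injective (v : Fin (n + 2)) : Function.Injective (val (k := k) (up := up) (S := S) v) :=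
  Subtype.val_injective

lemma subsingleton_space_thin (hv : v ∉ S) : Subsingleton ((thin k up S).Space v) :=
  subsingleton_of_forall_eq 0 fun x ↦ val_injective v ((mem_stalk.1 x.2 hv).trans (map_zero _).symm)

lemma val_eq_zero (hv : v ∉ S) (x : (thin k up S).Space v) : val v x = 0 :=
  mem_stalk.1 x.2 hv

lemma val_unit (hv : v ∈ S) : val v (unit v : (thin k up S).Space v) = 1 :=
  if_pos hv

lemma val_smul_unit (x : (thin k up S).Space v) : val v x • unit v = x := by
  refine val_injective v ?_
  rw [map_smul, smul_eq_mul]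
  by_cases hv : v ∈ S
  · rw [val_unit hv, mul_one]
  · rw [val_eq_zero hv x, zero_mul]

lemma finrank_thin_of_mem (hv : v ∈ S) : Module.finrank k ((thin k up S).Space v) = 1 :=
  finrank_eq_one (unit v)
    (fun h ↦ one_ne_zero ((val_unit hv).symm.trans ((congrArg _ h).trans (map_zero _))))
    fun x ↦ ⟨val v x, val_smul_unit x⟩

lemma finrank_thin_of_notMem (hv : v ∉ S) : Module.finrank k ((thin k up S).Space v) = 0 :=
  have := subsingleton_space_thin (k := k) (up := up) hv
  Module.finrank_zero_of_subsingleton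

lemma finrank_thin_le_one : Module.finrank k ((thin k up S).Space v) ≤ 1 := by
  by_cases hv : v ∈ S
  · exact (finrank_thin_of_mem hv).le
  · exact (finrank_thin_of_notMem hv).trans_le zero_le_one

lemma eq_of_iso_thin (e : thin k up S ≅ thin k up S') : S = S' := by
  ext v
  have h := finrank_eq_of_iso e v
  by_cases hv : v ∈ S <;> by_cases hv' : v ∈ S' <;>
    simp_all [finrank_thin_of_mem, finrank_thin_of_notMem]

section Arrow

variable {s t : Fin (n + 2)} (e : TypeAQuiver.Arrow up s t)

open Classical in
lemma val_arr (x : (thin k up S).Space s) :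
    val t ((thin k up S).arr e x) = if t ∈ S then val s x else 0 :=
  congrArg (val t) (arr_ofSpaces _ _ e x)

lemma val_arr_of_mem (ht : t ∈ S) (x : (thin k up S).Space s) :
    val t ((thin k up S).arr e x) = val s x := by
  rw [val_arr, if_pos ht]

lemma arr_unit (hs : s ∈ S) (ht : t ∈ S) : (thin k up S).arr e (unit s) = unit t :=
  val_injective t (by rw [val_arr_of_mem e ht, val_unit hs, val_unit ht])

end Arrow

/-- Morphisms from a thin representation, given by the images of the basis vectors. -/
noncomputable def fromThin (x : ∀ v, V.Space v) (hx : ∀ v ∉ S, x v = 0)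
    (h : ∀ (s t : Fin (n + 2)) (e : TypeAQuiver.Arrow up s t), s ∈ S → V.arr e (x s) = x t) :
    thin k up S ⟶ V :=
  ofApp (fun v ↦ (val v).smulRight (x v)) fun s t e c ↦ by
    rw [LinearMap.smulRight_apply, LinearMap.smulRight_apply, map_smul, val_arr]
    by_cases hs : s ∈ S
    · rw [h s t e hs]
      by_cases ht : t ∈ S
      · rw [if_pos ht]
      · rw [hx t ht, smul_zero, smul_zero]
    · rw [val_eq_zero hs, ite_self, zero_smul, zero_smul]

lemma app_fromThin (x : ∀ v, V.Space v) (hx) (h) (v : Fin (n + 2)) (c : (thin k up S).Space v) :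
    app (fromThin x hx h) v c = val v c • x v := rfl

/-- Morphisms to a thin representation, given by their coordinates. -/
noncomputable def toThin (ξ : ∀ v, V.Space v →ₗ[k] k) (hξ : ∀ v ∉ S, ξ v = 0)
    (h : ∀ (s t : Fin (n + 2)) (e : TypeAQuiver.Arrow up s t), t ∈ S → ξ t ∘ₗ V.arr e = ξ s) :
    V ⟶ thin k up S :=
  ofApp (fun v ↦ ((ξ v).codRestrict (stalk k (v ∈ S)) fun x ↦ mem_stalk.2 fun hv ↦ by
      rw [hξ v hv, LinearMap.zero_apply] : V.Space v →ₗ[k] stalk k (v ∈ S))) fun s t e x ↦ by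
    classical
    refine val_injective t ?_
    rw [val_arr]
    change ξ t (V.arr e x) = if t ∈ S then ξ s x else 0
    by_cases ht : t ∈ S
    · rw [if_pos ht, ← h s t e ht, LinearMap.comp_apply]
    · rw [if_neg ht, hξ t ht, LinearMap.zero_apply]

lemma val_app_toThin (ξ : ∀ v, V.Space v →ₗ[k] k) (hξ) (h) (v : Fin (n + 2)) (x : V.Space v) :
    val v (app (toThin (S := S) ξ hξ h) v x) = ξ v x := rfl

/-- A thin retract, given by vectors and by functionals which take the value `1` on them. -/
noncomputable def thinRetract (x : ∀ v, V.Space v) (ξ : ∀ v, V.Space v →ₗ[k] k)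
    (hx : ∀ v ∉ S, x v = 0) (hξ : ∀ v ∉ S, ξ v = 0)
    (hxe : ∀ (s t : Fin (n + 2)) (e : TypeAQuiver.Arrow up s t), s ∈ S → V.arr e (x s) = x t)
    (hξe : ∀ (s t : Fin (n + 2)) (e : TypeAQuiver.Arrow up s t), t ∈ S → ξ t ∘ₗ V.arr e = ξ s)
    (h : ∀ v ∈ S, ξ v (x v) = 1) : Retract (thin k up S) V where
  i := fromThin x hx hxe
  r := toThin ξ hξ hξe
  retract := hom_ext fun v c ↦ val_injective v <| by
    rw [app_comp, val_app_toThin, app_fromThin, map_smul, app_id, smul_eq_mul]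
    by_cases hv : v ∈ S
    · rw [h v hv, mul_one]
    · rw [val_eq_zero hv, zero_mul]

/-- The condition on two supports under which the maps that are the identity of `k` on `S ∩ S'` and
`0` elsewhere form a morphism between the thin representations: no arrow inside `S` leads into `S'`
from outside, and no arrow inside `S'` leads out of `S`. -/
def IsThinHom (up : Fin (n + 1) → Bool) (S S' : Set (Fin (n + 2))) : Prop :=
  ∀ ⦃s t : Fin (n + 2)⦄, TypeAQuiver.Arrow up s t → s ∈ S → t ∈ S' → (t ∈ S ↔ s ∈ S')

open Classical in
/-- The morphism between thin representations which is the identity of `k` wherever both of them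
are nonzero. -/
noncomputable def thinMap (h : IsThinHom up S S') : thin k up S ⟶ thin k up S' :=
  toThin (fun v ↦ if v ∈ S' then val v else 0) (fun v hv ↦ if_neg hv) fun s t e ht ↦ by
    ext x
    rw [if_pos ht, LinearMap.comp_apply, val_arr]
    by_cases hs : s ∈ S
    · by_cases ht' : t ∈ S
      · rw [if_pos ht', if_pos ((h e hs ht).1 ht')]
      · rw [if_neg ht', if_neg fun h' ↦ ht' ((h e hs ht).2 h'), LinearMap.zero_apply]
    · rw [val_eq_zero hs, ite_self]
      split_ifs
      · exact (val_eq_zero hs x).symm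
      · rfl

open Classical in
lemma val_app_thinMap (h : IsThinHom up S S') (v : Fin (n + 2)) (x : (thin k up S).Space v) :
    val v (app (thinMap h) v x) = if v ∈ S' then val v x else 0 := by
  rw [thinMap, val_app_toThin]
  split_ifs <;> rfl

section Endomorphism

variable (f : thin k up S ⟶ thin k up S)

lemma app_eq_val_app_unit_smul (x : (thin k up S).Space v) :
    app f v x = val v (app f v (unit v)) • x := by
  conv_lhs => rw [← val_smul_unit x, map_smul, ← val_smul_unit (app f v (unit v))]
  rw [smul_comm, val_smul_unit]

lemma val_app_unit_eq_of_arrow {s t : Fin (n + 2)} (e : TypeAQuiver.Arrow up s t) (hs : s ∈ S)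
    (ht : t ∈ S) : val s (app f s (unit s)) = val t (app f t (unit t)) := by
  rw [← arr_unit e hs ht, app_arr, val_arr_of_mem e ht]

lemma val_app_unit_eq (hS : S.OrdConnected) {s t : Fin (n + 2)} (hst : s ≤ t) (hs : s ∈ S)
    (ht : t ∈ S) : val s (app f s (unit s)) = val t (app f t (unit t)) := by
  induction t using Fin.induction with
  | zero => rw [Fin.le_zero_iff.1 hst]
  | succ a ih =>
    rcases hst.eq_or_lt with rfl | hlt
    · rfl
    have hsa : s ≤ a.castSucc := Fin.le_castSucc_iff.2 hlt
    have ha : a.castSucc ∈ S := hS.out hs ht ⟨hsa, Fin.castSucc_lt_succ.le⟩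
    refine (ih hsa ha).trans ?_
    rcases nonempty_arrow_or up a with ⟨⟨e⟩⟩ | ⟨⟨e⟩⟩
    · exact val_app_unit_eq_of_arrow f e ha ht
    · exact (val_app_unit_eq_of_arrow f e ht ha).symm

end Endomorphism

lemma isBrick_thin (hS : S.OrdConnected) (hne : S.Nonempty) : IsBrick k (thin k up S) := by
  obtain ⟨s, hs⟩ := hne
  refine ⟨fun hz ↦ ?_, fun f ↦ ⟨val s (app f s (unit s)), hom_ext fun v x ↦ ?_⟩⟩
  · have := isZero_iff_subsingleton.1 hz s
    exact one_ne_zero ((finrank_thin_of_mem (k := k) (up := up) hs).symm.trans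
      Module.finrank_zero_of_subsingleton)
  · rw [app_smul, app_id]
    by_cases hv : v ∈ S
    · rw [app_eq_val_app_unit_smul f x]
      rcases le_total s v with h | h
      · rw [val_app_unit_eq f hS h hs hv]
      · rw [val_app_unit_eq f hS h hv hs]
    · exact (subsingleton_space_thin hv).elim _ _

end TypeARep

namespace PolygonSegment

variable {n : ℕ}

/-- The vertices of the quiver which correspond to a line segment between `i` and `j`: those which
are the paper's `i + 1, …, j`, that is, the elements `i, …, j - 1` of `Fin (n + 2)`. -/
def support (γ : PolygonSegment n) : Set (Fin (n + 2)) :=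
  {v | γ.1.1.val ≤ v.val ∧ v.val < γ.1.2.val}

lemma mem_support {γ : PolygonSegment n} {v : Fin (n + 2)} :
    v ∈ γ.support ↔ γ.1.1.val ≤ v.val ∧ v.val < γ.1.2.val :=
  Iff.rfl

lemma ordConnected_support (γ : PolygonSegment n) : γ.support.OrdConnected :=
  ⟨fun _ hs _ ht _ hv ↦ ⟨hs.1.trans hv.1, (Fin.val_le_of_le hv.2).trans_lt ht.2⟩⟩

lemma support_nonempty (γ : PolygonSegment n) : γ.support.Nonempty :=
  have hγ : γ.1.1.val < γ.1.2.val := γ.2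
  ⟨⟨γ.1.1, by lia⟩, le_rfl, hγ⟩

lemma support_subset_iff {γ δ : PolygonSegment n} :
    γ.support ⊆ δ.support ↔ δ.1.1 ≤ γ.1.1 ∧ γ.1.2 ≤ δ.1.2 := by
  have hγ : γ.1.1.val < γ.1.2.val := γ.2
  refine ⟨fun h ↦ ?_, fun h v hv ↦
    ⟨(Fin.le_def.1 h.1).trans hv.1, hv.2.trans_le (Fin.le_def.1 h.2)⟩⟩
  have hfst := (h (a := ⟨γ.1.1, by lia⟩) ⟨le_rfl, hγ⟩).1
  have hsnd := (h (a := ⟨γ.1.2 - 1, by lia⟩) ⟨Nat.le_sub_one_of_lt hγ, Nat.sub_one_lt_of_lt hγ⟩).2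
  exact ⟨hfst, Fin.le_def.2 (Nat.le_of_pred_lt hsnd)⟩

lemma support_injective : Function.Injective (support (n := n)) := fun _ _ h ↦
  have h₁ := support_subset_iff.1 h.subset
  have h₂ := support_subset_iff.1 h.superset
  Subtype.ext (Prod.ext (le_antisymm h₂.1 h₁.1) (le_antisymm h₁.2 h₂.2))

end PolygonSegment

namespace TypeARep

variable {k : Type u} [Field k] {n : ℕ} {up : Fin (n + 1) → Bool} {γ δ : PolygonSegment n}

/-- The indecomposable representation which corresponds to a line segment of the polygon. -/
noncomputable abbrev segmentRep (k : Type u) [Field k] {n : ℕ} (up : Fin (n + 1) → Bool)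
    (γ : PolygonSegment n) : TypeARep k up :=
  thin k up γ.support

lemma isBrick_segmentRep (γ : PolygonSegment n) : IsBrick k (segmentRep k up γ) :=
  isBrick_thin γ.ordConnected_support γ.support_nonempty

lemma indecomposable_segmentRep (γ : PolygonSegment n) : Indecomposable (segmentRep k up γ) :=
  (isBrick_segmentRep (k := k) γ).indecomposable

lemma eq_of_iso_segmentRep (e : segmentRep k up γ ≅ segmentRep k up δ) : γ = δ :=
  PolygonSegment.support_injective (eq_of_iso_thin e)

lemma eq_of_retract_segmentRep (h : Retract (segmentRep k up γ) (segmentRep k up δ)) : γ = δ :=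
  (nonempty_iso_of_retract_indecomposable h (isBrick_segmentRep (k := k) γ).1
    (indecomposable_segmentRep δ)).elim eq_of_iso_segmentRep

end TypeARep

section LinearAlgebra

variable {k V W U : Type*} [Field k] [AddCommGroup V] [Module k V] [AddCommGroup W] [Module k W]
  [AddCommGroup U] [Module k U]

lemma exists_comp_eq_of_ker_le_ker (g : V →ₗ[k] W) (ξ : V →ₗ[k] U)
    (h : LinearMap.ker g ≤ LinearMap.ker ξ) : ∃ η : W →ₗ[k] U, η ∘ₗ g = ξ := by
  obtain ⟨η, hη⟩ := ((LinearMap.ker g).liftQ ξ h ∘ₗ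
    g.quotKerEquivRange.symm.toLinearMap).exists_extend
  refine ⟨η, LinearMap.ext fun x ↦ ?_⟩
  have hx := LinearMap.congr_fun hη (g.quotKerEquivRange (Submodule.Quotient.mk x))
  simp only [LinearMap.comp_apply, LinearEquiv.coe_coe, LinearEquiv.symm_apply_apply] at hx
  exact hx

lemma exists_comp_eq_of_comap_le_ker (g : V →ₗ[k] W) (B : Submodule k W) (ξ : V →ₗ[k] U)
    (h : B.comap g ≤ LinearMap.ker ξ) : ∃ η : W →ₗ[k] U, η ∘ₗ g = ξ ∧ B ≤ LinearMap.ker η := by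
  obtain ⟨η, hη⟩ := exists_comp_eq_of_ker_le_ker (B.mkQ ∘ₗ g) ξ
    (by rwa [LinearMap.ker_comp, Submodule.ker_mkQ])
  refine ⟨η ∘ₗ B.mkQ, hη, ?_⟩
  conv_lhs => rw [← B.ker_mkQ]
  exact LinearMap.ker_le_ker_comp _ _

lemma exists_le_ker_apply_eq_one (B : Submodule k V) {x : V} (hx : x ∉ B) :
    ∃ ξ : V →ₗ[k] k, B ≤ LinearMap.ker ξ ∧ ξ x = 1 := by
  obtain ⟨ξ, hξx, hξB⟩ := B.exists_le_ker_of_notMem hx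
  refine ⟨(ξ x)⁻¹ • ξ, fun b hb ↦ ?_, inv_mul_cancel₀ hξx⟩
  rw [LinearMap.mem_ker, LinearMap.smul_apply, LinearMap.mem_ker.1 (hξB hb), smul_zero]

end LinearAlgebra

namespace TypeARep

variable {k : Type u} [Field k] {n : ℕ} {up : Fin (n + 1) → Bool} {V : TypeARep k up}

/-- A thin retract, with support `[v, finish)`, of the restriction of `V` to the vertices from `v`
on: the vectors `vec` are the inclusion, and the functionals `form` are the projection. Peeling off
the vertices from left to right, such retracts split every representation into thin ones. The
support is empty if `finish = v`. -/
structure TailRetract (V : TypeARep k up) (v : Fin (n + 2)) where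
  /-- the end of the support -/
  finish : ℕ
  le_finish : v.val ≤ finish
  finish_le : finish ≤ n + 2
  /-- the images of the basis vectors -/
  vec : ∀ w, V.Space w
  /-- the coordinates of the projection -/
  form : ∀ w, V.Space w →ₗ[k] k
  vec_eq_zero : ∀ w, ¬ (v.val ≤ w.val ∧ w.val < finish) → vec w = 0
  form_eq_zero : ∀ w, ¬ (v.val ≤ w.val ∧ w.val < finish) → form w = 0
  arr_vec : ∀ (s t : Fin (n + 2)) (e : TypeAQuiver.Arrow up s t), v ≤ s → v ≤ t →
    s.val < finish → V.arr e (vec s) = vec t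
  form_arr : ∀ (s t : Fin (n + 2)) (e : TypeAQuiver.Arrow up s t), v ≤ s → v ≤ t →
    t.val < finish → form t ∘ₗ V.arr e = form s
  form_vec : ∀ w, v.val ≤ w.val → w.val < finish → form w (vec w) = 1

namespace TailRetract

variable {a : Fin (n + 1)}

/-- The retract with empty support. -/
noncomputable def empty (V : TypeARep k up) (v : Fin (n + 2)) : TailRetract V v where
  finish := v
  le_finish := le_rfl
  finish_le := v.2.le
  vec := 0
  form := 0
  vec_eq_zero _ _ := rfl
  form_eq_zero _ _ := rfl
  arr_vec _ _ _ _ _ _ := map_zero _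
  form_arr _ _ _ _ _ _ := LinearMap.zero_comp _
  form_vec _ h h' := absurd h h'.not_ge

open Classical in
/-- The retract supported at the last vertex. -/
noncomputable def last (x : V.Space (Fin.last (n + 1))) (ξ : V.Space (Fin.last (n + 1)) →ₗ[k] k)
    (h : ξ x = 1) : TailRetract V (Fin.last (n + 1)) where
  finish := n + 2
  le_finish := Nat.le_succ _
  finish_le := le_rfl
  vec := Pi.single _ x
  form := Pi.single _ ξ
  vec_eq_zero w hw := Pi.single_eq_of_ne (by rintro rfl; exact hw ⟨le_rfl, Nat.lt_succ_self _⟩) _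
  form_eq_zero w hw := Pi.single_eq_of_ne (by rintro rfl; exact hw ⟨le_rfl, Nat.lt_succ_self _⟩) _
  arr_vec s t e hs ht _ := by
    rcases e with ⟨b, -⟩ | ⟨b, -⟩ <;>
      simp only [Fin.le_def, Fin.val_last, Fin.val_castSucc, Fin.val_succ] at hs ht <;> lia
  form_arr s t e hs ht _ := by
    rcases e with ⟨b, -⟩ | ⟨b, -⟩ <;>
      simp only [Fin.le_def, Fin.val_last, Fin.val_castSucc, Fin.val_succ] at hs ht <;> lia
  form_vec w hw _ := by
    obtain rfl : w = Fin.last (n + 1) := le_antisymm (Fin.le_last w) hw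
    rw [Pi.single_eq_same, Pi.single_eq_same, h]

lemma update_castSucc_of_le {M : Fin (n + 2) → Type*} (f : ∀ w, M w) (x : M a.castSucc)
    {w : Fin (n + 2)} (hw : a.succ ≤ w) : Function.update f a.castSucc x w = f w :=
  Function.update_of_ne (Fin.castSucc_lt_succ.trans_le hw).ne' _ _

open Classical in
lemma update_castSucc_eq_zero {M : Fin (n + 2) → Type*} [∀ w, Zero (M w)] {f : ∀ w, M w} {m : ℕ}
    (hm : a.succ.val ≤ m) (hf : ∀ w, ¬ (a.succ.val ≤ w.val ∧ w.val < m) → f w = 0)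
    (x : M a.castSucc) (w : Fin (n + 2)) (hw : ¬ (a.castSucc.val ≤ w.val ∧ w.val < m)) :
    Function.update f a.castSucc x w = 0 := by
  rw [Function.update_of_ne (by rintro rfl; exact hw ⟨le_rfl, hm⟩)]
  exact hf w fun h ↦ hw ⟨(Nat.le_succ _).trans h.1, h.2⟩

lemma forall_arrow_of_castSucc {P : ∀ s t, TypeAQuiver.Arrow up s t → Prop}
    (hright : ∀ h : up a = true, P _ _ (.right a h))
    (hleft : ∀ h : up a = false, P _ _ (.left a h))
    (htail : ∀ s t e, a.succ ≤ s → a.succ ≤ t → P s t e) (s t : Fin (n + 2))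
    (e : TypeAQuiver.Arrow up s t) (hs : a.castSucc ≤ s) (ht : a.castSucc ≤ t) : P s t e := by
  rcases e with ⟨b, hb⟩ | ⟨b, hb⟩ <;> rcases eq_or_ne b a with rfl | hba
  · exact hright hb
  · have hab : a.succ ≤ b.castSucc := Fin.succ_le_castSucc_iff.2 (lt_of_le_of_ne hs hba.symm)
    exact htail _ _ _ hab (hab.trans Fin.castSucc_lt_succ.le)
  · exact hleft hb
  · have hab : a.succ ≤ b.castSucc := Fin.succ_le_castSucc_iff.2 (lt_of_le_of_ne ht hba.symm)
    exact htail _ _ _ (hab.trans Fin.castSucc_lt_succ.le) hab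

open Classical in
/-- Extension of a retract by one vertex to the left. If the support is empty, the two conditional
compatibilities at the new arrow are void. -/
noncomputable def cons (R : TailRetract V a.succ) (x : V.Space a.castSucc)
    (ξ : V.Space a.castSucc →ₗ[k] k) (h : ξ x = 1)
    (hright : ∀ h : up a = true, V.arr (.right a h) x = R.vec a.succ ∧
      (a.succ.val < R.finish → R.form a.succ ∘ₗ V.arr (.right a h) = ξ))
    (hleft : ∀ h : up a = false, ξ ∘ₗ V.arr (.left a h) = R.form a.succ ∧
      (a.succ.val < R.finish → V.arr (.left a h) (R.vec a.succ) = x)) :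
    TailRetract V a.castSucc where
  finish := R.finish
  le_finish := (Nat.le_succ _).trans R.le_finish
  finish_le := R.finish_le
  vec := Function.update R.vec a.castSucc x
  form := Function.update R.form a.castSucc ξ
  vec_eq_zero := update_castSucc_eq_zero R.le_finish R.vec_eq_zero x
  form_eq_zero := update_castSucc_eq_zero R.le_finish R.form_eq_zero ξ
  arr_vec := forall_arrow_of_castSucc
    (fun hb _ ↦ by
      rw [Function.update_self, update_castSucc_of_le _ _ le_rfl, (hright hb).1])
    (fun hb hlt ↦ by
      rw [Function.update_self, update_castSucc_of_le _ _ le_rfl, (hleft hb).2 hlt])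
    fun s t e hs ht hlt ↦ by
      rw [update_castSucc_of_le _ _ hs, update_castSucc_of_le _ _ ht, R.arr_vec s t e hs ht hlt]
  form_arr := forall_arrow_of_castSucc
    (fun hb hlt ↦ by
      rw [Function.update_self, update_castSucc_of_le _ _ le_rfl, (hright hb).2 hlt])
    (fun hb _ ↦ by
      rw [Function.update_self, update_castSucc_of_le _ _ le_rfl, (hleft hb).1])
    fun s t e hs ht hlt ↦ by
      rw [update_castSucc_of_le _ _ hs, update_castSucc_of_le _ _ ht, R.form_arr s t e hs ht hlt]
  form_vec w hw hlt := by
    rcases eq_or_ne w a.castSucc with rfl | hwa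
    · rw [Function.update_self, Function.update_self, h]
    · rw [Function.update_of_ne hwa, Function.update_of_ne hwa]
      exact R.form_vec w (lt_of_le_of_ne hw (Fin.val_ne_of_ne hwa.symm)) hlt

lemma exists_right (h : up a = true) {A B : Submodule k (V.Space a.castSucc)} (hBA : B ≤ A)
    (hAB : ¬ A ≤ B)
    (ih : ∀ A B : Submodule k (V.Space a.succ), B ≤ A → ¬ A ≤ B →
      ∃ R : TailRetract V a.succ, a.succ.val < R.finish ∧ R.vec a.succ ∈ A ∧
        B ≤ LinearMap.ker (R.form a.succ)) :
    ∃ R : TailRetract V a.castSucc, a.castSucc.val < R.finish ∧ R.vec a.castSucc ∈ A ∧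
      B ≤ LinearMap.ker (R.form a.castSucc) := by
  have hno : ¬ up a = false := by simp [h]
  set g := V.arr (.right a h)
  by_cases hA : A ⊓ LinearMap.ker g ≤ B
  · have hne : ¬ A.map g ≤ B.map g := fun hle ↦ hAB fun x hx ↦ by
      obtain ⟨b, hb, hbx⟩ := hle (Submodule.mem_map_of_mem hx)
      have hxb : x - b ∈ B := hA ⟨A.sub_mem hx (hBA hb), by simp [hbx]⟩
      exact (B.sub_mem_iff_left hb).1 hxb
    obtain ⟨R, hlt, ⟨x, hxA, hx⟩, hRB⟩ := ih _ _ (Submodule.map_mono hBA) hne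
    refine ⟨R.cons x (R.form a.succ ∘ₗ g) ?_ (fun _ ↦ ⟨hx, fun _ ↦ rfl⟩)
      fun h' ↦ absurd h' hno, (Nat.le_succ _).trans_lt hlt, ?_, ?_⟩
    · rw [LinearMap.comp_apply, hx, R.form_vec _ le_rfl hlt]
    · simpa [cons] using hxA
    · simpa [cons, LinearMap.ker_comp] using Submodule.map_le_iff_le_comap.1 hRB
  · obtain ⟨x, ⟨hxA, hx⟩, hxB⟩ := SetLike.not_le_iff_exists.1 hA
    obtain ⟨ξ, hξ, hξx⟩ := exists_le_ker_apply_eq_one _ hxB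
    refine ⟨(empty V a.succ).cons x ξ hξx (fun _ ↦ ⟨hx, fun h ↦ absurd h (lt_irrefl _)⟩)
      fun h' ↦ absurd h' hno, Nat.lt_succ_self _, ?_, ?_⟩
    · simpa [cons] using hxA
    · simpa [cons] using hξ

lemma exists_left (h : up a = false) {A B : Submodule k (V.Space a.castSucc)} (hBA : B ≤ A)
    (hAB : ¬ A ≤ B)
    (ih : ∀ A B : Submodule k (V.Space a.succ), B ≤ A → ¬ A ≤ B →
      ∃ R : TailRetract V a.succ, a.succ.val < R.finish ∧ R.vec a.succ ∈ A ∧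
        B ≤ LinearMap.ker (R.form a.succ)) :
    ∃ R : TailRetract V a.castSucc, a.castSucc.val < R.finish ∧ R.vec a.castSucc ∈ A ∧
      B ≤ LinearMap.ker (R.form a.castSucc) := by
  have hno : ¬ up a = true := by simp [h]
  set g := V.arr (.left a h)
  by_cases hA : A ≤ B ⊔ LinearMap.range g
  · have hne : ¬ A.comap g ≤ B.comap g := fun hle ↦ hAB fun x hx ↦ by
      obtain ⟨b, hb, _, ⟨y, rfl⟩, rfl⟩ := Submodule.mem_sup.1 (hA hx)
      exact B.add_mem hb (hle (Submodule.mem_comap.2 ((A.add_mem_iff_right (hBA hb)).1 hx)))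
    obtain ⟨R, hlt, hRA, hRB⟩ := ih _ _ (Submodule.comap_mono hBA) hne
    obtain ⟨ξ, hξ, hξB⟩ := exists_comp_eq_of_comap_le_ker g B _ hRB
    refine ⟨R.cons (g (R.vec a.succ)) ξ ?_ (fun h' ↦ absurd h' hno)
      fun _ ↦ ⟨hξ, fun _ ↦ rfl⟩, (Nat.le_succ _).trans_lt hlt, ?_, ?_⟩
    · rw [← LinearMap.comp_apply, hξ, R.form_vec _ le_rfl hlt]
    · simpa [cons] using hRA
    · simpa [cons] using hξB
  · obtain ⟨x, hxA, hxB⟩ := SetLike.not_le_iff_exists.1 hA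
    obtain ⟨ξ, hξ, hξx⟩ := exists_le_ker_apply_eq_one _ hxB
    have hξg : ξ ∘ₗ g = 0 :=
      LinearMap.range_le_ker_iff.1 (le_sup_right.trans hξ)
    refine ⟨(empty V a.succ).cons x ξ hξx (fun h' ↦ absurd h' hno)
      fun _ ↦ ⟨hξg, fun h ↦ absurd h (lt_irrefl _)⟩, Nat.lt_succ_self _, ?_, ?_⟩
    · simpa [cons] using hxA
    · simpa [cons] using le_sup_left.trans hξ

/- The subspaces `A` and `B` record what the part of the representation to the left of `v` imposes
on the vector and on the functional at `v`. -/
lemma exists_vec_mem_le_ker_form (V : TypeARep k up) (v : Fin (n + 2)) :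
    ∀ A B : Submodule k (V.Space v), B ≤ A → ¬ A ≤ B → ∃ R : TailRetract V v, v.val < R.finish ∧
      R.vec v ∈ A ∧ B ≤ LinearMap.ker (R.form v) := by
  induction v using Fin.reverseInduction with
  | last =>
    intro A B _ hAB
    obtain ⟨x, hxA, hxB⟩ := SetLike.not_le_iff_exists.1 hAB
    obtain ⟨ξ, hξ, hξx⟩ := exists_le_ker_apply_eq_one B hxB
    exact ⟨last x ξ hξx, Nat.lt_succ_self _, by simpa [last] using hxA, by simpa [last] using hξ⟩
  | cast a ih =>
    intro A B hBA hAB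
    cases h : up a
    · exact exists_left h hBA hAB ih
    · exact exists_right h hBA hAB ih

end TailRetract

lemma exists_retract_segmentRep (hV : ¬ IsZero V) :
    ∃ γ : PolygonSegment n, Nonempty (Retract (segmentRep k up γ) V) := by
  obtain ⟨v, hv, hmin⟩ : ∃ v, Nontrivial (V.Space v) ∧ ∀ w < v, Subsingleton (V.Space w) := by
    have hne : {v | Nontrivial (V.Space v)}.Nonempty := by
      by_contra! h
      exact hV (isZero_iff_subsingleton.2 fun v ↦
        not_nontrivial_iff_subsingleton.1 (Set.eq_empty_iff_forall_notMem.1 h v))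
    obtain ⟨v, hv, hmin⟩ := wellFounded_lt.has_min _ hne
    exact ⟨v, hv, fun w hw ↦ not_nontrivial_iff_subsingleton.1 fun h ↦ hmin w h hw⟩
  obtain ⟨R, hlt, -⟩ := TailRetract.exists_vec_mem_le_ker_form V v ⊤ ⊥ bot_le
    fun h ↦ bot_ne_top (top_le_iff.1 h)
  have hle := R.finish_le
  refine ⟨⟨(⟨v, by lia⟩, ⟨R.finish, by lia⟩), hlt⟩,
    ⟨thinRetract R.vec R.form R.vec_eq_zero R.form_eq_zero (fun s t e hs ↦ ?_)
      (fun s t e ht ↦ ?_) fun w hw ↦ R.form_vec w hw.1 hw.2⟩⟩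
  · by_cases hvt : v ≤ t
    · exact R.arr_vec s t e hs.1 hvt hs.2
    · exact (hmin t (not_le.1 hvt)).elim _ _
  · by_cases hvs : v ≤ s
    · exact R.form_arr s t e hvs ht.1 ht.2
    · have := hmin s (not_le.1 hvs)
      exact Subsingleton.elim _ _

lemma exists_iso_segmentRep (hV : Indecomposable V) :
    ∃ γ : PolygonSegment n, Nonempty (V ≅ segmentRep k up γ) := by
  obtain ⟨γ, ⟨h⟩⟩ := exists_retract_segmentRep hV.1
  obtain ⟨e⟩ := nonempty_iso_of_retract_indecomposable h (isBrick_segmentRep (k := k) γ).1 hV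
  exact ⟨γ, ⟨e.symm⟩⟩

end TypeARep

/-! ### Crossing segments and the vanishing of extensions -/

/-- The vertices of the polygon which lie above the line through the first and the last vertex. They
are natural numbers, in order that linear arithmetic applies to inequalities between vertices of the
polygon and of the quiver. -/
def upperVertices {n : ℕ} (up : Fin (n + 1) → Bool) : Set ℕ :=
  {m | ∃ a : Fin (n + 1), a.val + 1 = m ∧ up a = true}

/-- The combinatorial form of the condition that the segments `(i, j)` and `(k, l)` of a convex
polygon cross and that the first one has the smaller slope, where `U` is the set of vertices on the
upper side. Where the two segments begin to lie above each other, the second one is below the first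
one, and where they end to do so, it is above. -/
def CrossesUpward (U : Set ℕ) (i j k l : ℕ) : Prop :=
  max i k < min j l ∧ (i < k ∧ k ∉ U ∨ k < i ∧ i ∈ U) ∧ (j < l ∧ j ∉ U ∨ l < j ∧ l ∈ U)

namespace PolygonSegment

variable {n : ℕ}

/-- `CrossesUpward` for the line segments of the polygon. -/
def CrossesUpward (up : Fin (n + 1) → Bool) (γ δ : PolygonSegment n) : Prop :=
  _root_.CrossesUpward (upperVertices up) γ.1.1 γ.1.2 δ.1.1 δ.1.2

/-- The segments `γ` and `δ` meet in an end point, such that there is an extension of the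
indecomposable representation of `δ` by the one of `γ` with indecomposable middle term. -/
def AbutsUpward (up : Fin (n + 1) → Bool) (γ δ : PolygonSegment n) : Prop :=
  γ.1.1 = δ.1.2 ∧ γ.1.1.val ∈ upperVertices up ∨ δ.1.1 = γ.1.2 ∧ δ.1.1.val ∉ upperVertices up

end PolygonSegment

lemma exists_forall_succ {m : ℕ} {M : Fin (m + 1) → Type*}
    {P : ∀ a : Fin m, M a.castSucc → M a.succ → Prop} (x : M 0) (h : ∀ a x, ∃ y, P a x y) :
    ∃ u : ∀ v, M v, ∀ a : Fin m, P a (u a.castSucc) (u a.succ) := by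
  choose next hnext using h
  exact ⟨Fin.induction x next, fun a ↦ by
    beta_reduce; rw [Fin.induction_succ]; exact hnext _ _⟩

lemma exists_forall_castSucc {m : ℕ} {M : Fin (m + 1) → Type*}
    {P : ∀ a : Fin m, M a.castSucc → M a.succ → Prop} (y : M (Fin.last m))
    (h : ∀ a y, ∃ x, P a x y) : ∃ u : ∀ v, M v, ∀ a : Fin m, P a (u a.castSucc) (u a.succ) := by
  choose next hnext using h
  exact ⟨Fin.reverseInduction y next, fun a ↦ by
    beta_reduce; rw [Fin.reverseInduction_castSucc]; exact hnext _ _⟩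

namespace TypeARep

variable {k : Type u} [Field k] {n : ℕ} {up : Fin (n + 1) → Bool} {X Y : TypeARep k up}
  {s t : Fin (n + 2)}

lemma mem_upperVertices_of_arrow (e : TypeAQuiver.Arrow up s t) :
    s.val + 1 = t.val ∧ t.val ∈ upperVertices up ∨
      t.val + 1 = s.val ∧ s.val ∉ upperVertices up := by
  rcases e with ⟨a, h⟩ | ⟨a, h⟩
  · exact .inl ⟨rfl, a, rfl, h⟩
  · refine .inr ⟨rfl, ?_⟩
    rintro ⟨b, hb, hb'⟩
    obtain rfl : b = a := Fin.ext (Nat.succ_injective hb)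
    exact Bool.false_ne_true (h.symm.trans hb')

/- An extension is split at each vertex, and the failure of these splittings to commute with the
arrows is the cocycle. -/
lemma subsingleton_ext_of_forall_cocycle
    (H : ∀ φ : ∀ s t : Fin (n + 2), TypeAQuiver.Arrow up s t → (X.Space s →ₗ[k] Y.Space t),
      ∃ u : ∀ v, X.Space v →ₗ[k] Y.Space v, ∀ s t e,
        φ s t e = Y.arr e ∘ₗ u s - u t ∘ₗ X.arr e) :
    Subsingleton (Abelian.Ext X Y 1) := by
  refine subsingleton_ext_one_of_forall_extends X Y fun K Z f g w hS h ↦ ?_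
  have hgf (v) : app g v ∘ₗ app f v = 0 := LinearMap.ext fun y ↦ by
    rw [LinearMap.comp_apply, ← app_comp, w, app_zero, LinearMap.zero_apply]
  choose η hη using fun v ↦ exists_comp_eq_of_ker_le_ker (app f v) (app h v)
    ((LinearMap.ker_eq_bot.2 (injective_of_shortExact hS v)).trans_le bot_le)
  have hφ (s t : Fin (n + 2)) (e : TypeAQuiver.Arrow up s t) :
      ∃ φ, φ ∘ₗ app g s = Y.arr e ∘ₗ η s - η t ∘ₗ Z.arr e := by
    refine exists_comp_eq_of_ker_le_ker _ _ ?_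
    rw [(exact_of_shortExact hS s).linearMap_ker_eq, LinearMap.range_le_ker_iff]
    ext y
    have hs := LinearMap.congr_fun (hη s) y
    have ht := LinearMap.congr_fun (hη t) (K.arr e y)
    simp only [LinearMap.comp_apply, app_arr] at hs ht
    simp only [LinearMap.comp_apply, LinearMap.sub_apply, hs, ht, sub_self, LinearMap.zero_apply]
  choose φ hφ using hφ
  obtain ⟨u, hu⟩ := H φ
  refine ⟨ofApp (fun v ↦ η v - u v ∘ₗ app g v) fun s t e z ↦ ?_, hom_ext fun v y ↦ ?_⟩
  · have hz := LinearMap.congr_fun (hφ s t e) z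
    rw [hu] at hz
    simp only [LinearMap.comp_apply, LinearMap.sub_apply, app_arr, map_sub] at hz ⊢
    rwa [sub_eq_sub_iff_add_eq_add, add_comm, ← sub_eq_sub_iff_add_eq_add]
  · have hy := LinearMap.congr_fun (hη v) y
    have hy' := LinearMap.congr_fun (hgf v) y
    simp only [LinearMap.comp_apply, LinearMap.zero_apply] at hy hy'
    rw [app_comp, app_ofApp, LinearMap.sub_apply, LinearMap.comp_apply, hy, hy', map_zero, sub_zero]

/-- The linear maps `x` at the vertex `a` and `y` at the vertex `a + 1` exhibit the cochain `φ` as a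
coboundary at the arrow between these vertices. -/
def IsCoboundaryAt (φ : ∀ s t : Fin (n + 2), TypeAQuiver.Arrow up s t → (X.Space s →ₗ[k] Y.Space t))
    (a : Fin (n + 1)) (x : X.Space a.castSucc →ₗ[k] Y.Space a.castSucc)
    (y : X.Space a.succ →ₗ[k] Y.Space a.succ) : Prop :=
  (∀ h : up a = true, φ _ _ (.right a h) = Y.arr (.right a h) ∘ₗ x - y ∘ₗ X.arr (.right a h)) ∧
    ∀ h : up a = false, φ _ _ (.left a h) = Y.arr (.left a h) ∘ₗ y - x ∘ₗ X.arr (.left a h)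

lemma subsingleton_ext_of_forall_isCoboundaryAt
    (H : ∀ φ : ∀ s t : Fin (n + 2), TypeAQuiver.Arrow up s t → (X.Space s →ₗ[k] Y.Space t),
      ∃ u : ∀ v, X.Space v →ₗ[k] Y.Space v, ∀ a, IsCoboundaryAt φ a (u a.castSucc) (u a.succ)) :
    Subsingleton (Abelian.Ext X Y 1) := by
  refine subsingleton_ext_of_forall_cocycle fun φ ↦ ?_
  obtain ⟨u, hu⟩ := H φ
  refine ⟨u, ?_⟩
  rintro _ _ (⟨a, h⟩ | ⟨a, h⟩)
  · exact (hu a).1 h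
  · exact (hu a).2 h

/-- Every linear map from the space of `X` at the source of `e` to the space of `Y` at its target
extends along the map of `X`. -/
def Extends (X Y : TypeARep k up) (e : TypeAQuiver.Arrow up s t) : Prop :=
  ∀ ψ : X.Space s →ₗ[k] Y.Space t, ∃ u : X.Space t →ₗ[k] Y.Space t, u ∘ₗ X.arr e = ψ

/-- Every linear map from the space of `X` at the source of `e` to the space of `Y` at its target
lifts along the map of `Y`. -/
def Lifts (X Y : TypeARep k up) (e : TypeAQuiver.Arrow up s t) : Prop :=
  ∀ ψ : X.Space s →ₗ[k] Y.Space t, ∃ u : X.Space s →ₗ[k] Y.Space s, Y.arr e ∘ₗ u = ψ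

lemma subsingleton_ext_of_rightward (hright : ∀ a (h : up a = true), Extends X Y (.right a h))
    (hleft : ∀ a (h : up a = false), Lifts X Y (.left a h)) :
    Subsingleton (Abelian.Ext X Y 1) := by
  refine subsingleton_ext_of_forall_isCoboundaryAt fun φ ↦ exists_forall_succ 0 fun a x ↦ ?_
  cases h : up a
  · obtain ⟨y, hy⟩ := hleft a h (φ _ _ (.left a h) + x ∘ₗ X.arr (.left a h))
    exact ⟨y, fun h' ↦ absurd (h.symm.trans h') Bool.false_ne_true, fun _ ↦ by
      rw [hy, add_sub_cancel_right]⟩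
  · obtain ⟨y, hy⟩ := hright a h (Y.arr (.right a h) ∘ₗ x - φ _ _ (.right a h))
    exact ⟨y, fun _ ↦ by rw [hy, sub_sub_cancel],
      fun h' ↦ absurd (h'.symm.trans h) Bool.false_ne_true⟩

lemma subsingleton_ext_of_leftward (hright : ∀ a (h : up a = true), Lifts X Y (.right a h))
    (hleft : ∀ a (h : up a = false), Extends X Y (.left a h)) :
    Subsingleton (Abelian.Ext X Y 1) := by
  refine subsingleton_ext_of_forall_isCoboundaryAt fun φ ↦ exists_forall_castSucc 0 fun a y ↦ ?_
  cases h : up a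
  · obtain ⟨x, hx⟩ := hleft a h (Y.arr (.left a h) ∘ₗ y - φ _ _ (.left a h))
    exact ⟨x, fun h' ↦ absurd (h.symm.trans h') Bool.false_ne_true, fun _ ↦ by
      rw [hx, sub_sub_cancel]⟩
  · obtain ⟨x, hx⟩ := hright a h (φ _ _ (.right a h) + y ∘ₗ X.arr (.right a h))
    exact ⟨x, fun _ ↦ by rw [hx, add_sub_cancel_right],
      fun h' ↦ absurd (h'.symm.trans h) Bool.false_ne_true⟩

variable {S S' : Set (Fin (n + 2))}

lemma extends_thin (e : TypeAQuiver.Arrow up s t) (h : s ∈ S → t ∈ S' → t ∈ S) :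
    Extends (thin k up S) (thin k up S') e := fun ψ ↦ by
  refine ⟨(val t).smulRight (ψ (unit s)), LinearMap.ext fun x ↦ ?_⟩
  by_cases hs : s ∈ S
  · by_cases ht : t ∈ S'
    · rw [LinearMap.comp_apply, LinearMap.smulRight_apply, val_arr_of_mem e (h hs ht), ← map_smul,
        val_smul_unit]
    · exact (subsingleton_space_thin ht).elim _ _
  · rw [(subsingleton_space_thin hs).elim x 0, map_zero, map_zero]

lemma lifts_thin (e : TypeAQuiver.Arrow up s t) (h : s ∈ S → t ∈ S' → s ∈ S') :
    Lifts (thin k up S) (thin k up S') e := fun ψ ↦ by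
  refine ⟨(val t ∘ₗ ψ).smulRight (unit s), LinearMap.ext fun x ↦ ?_⟩
  by_cases hs : s ∈ S
  · by_cases ht : t ∈ S'
    · rw [LinearMap.comp_apply, LinearMap.smulRight_apply, map_smul, arr_unit e (h hs ht) ht,
        LinearMap.comp_apply, val_smul_unit]
    · exact (subsingleton_space_thin ht).elim _ _
  · rw [(subsingleton_space_thin hs).elim x 0, map_zero, map_zero]

/- If `δ` leaves `γ` to the right, the linear maps of a coboundary are chosen from right to left,
starting outside of the support of `γ`; otherwise they are chosen from left to right. -/
lemma subsingleton_ext_segmentRep {γ δ : PolygonSegment n} (h : ¬ δ.CrossesUpward up γ)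
    (h' : ¬ δ.AbutsUpward up γ) :
    Subsingleton (Abelian.Ext (segmentRep k up γ) (segmentRep k up δ) 1) := by
  obtain ⟨⟨⟨i, hi⟩, ⟨j, hj⟩⟩, hij⟩ := γ
  obtain ⟨⟨⟨i', hi'⟩, ⟨j', hj'⟩⟩, hij'⟩ := δ
  simp only [PolygonSegment.CrossesUpward, CrossesUpward, PolygonSegment.AbutsUpward,
    Fin.mk.injEq] at *
  by_cases hR : i' ≤ j ∧ j < j' ∧ j ∈ upperVertices up ∨
      i ≤ j' ∧ j' < j ∧ j' ∉ upperVertices up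
  · refine subsingleton_ext_of_leftward (fun a e ↦ lifts_thin _ ?_) fun a e ↦ extends_thin _ ?_
    · have := mem_upperVertices_of_arrow (.right a e)
      simp only [PolygonSegment.mem_support]
      grind
    · have := mem_upperVertices_of_arrow (.left a e)
      simp only [PolygonSegment.mem_support]
      grind
  · refine subsingleton_ext_of_rightward (fun a e ↦ extends_thin _ ?_) fun a e ↦ lifts_thin _ ?_
    · have := mem_upperVertices_of_arrow (.right a e)
      simp only [PolygonSegment.mem_support]
      grind
    · have := mem_upperVertices_of_arrow (.left a e)
      simp only [PolygonSegment.mem_support]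
      grind

end TypeARep

/-! ### Short exact sequences of thin representations -/

namespace TypeARep

variable {k : Type u} [Field k] {n : ℕ} {up : Fin (n + 1) → Bool}

lemma app_inl_add_app_inr {V W : TypeARep k up} (v : Fin (n + 2)) (x : (V ⊞ W).Space v) :
    app biprod.inl v (app biprod.fst v x) + app biprod.inr v (app biprod.snd v x) = x := by
  conv_rhs => rw [← app_id (V := V ⊞ W) v x, ← biprod.total]
  rfl

lemma shortExact_of_square {Y E E' X : TypeARep k up} (p : Y ⟶ E) (q : Y ⟶ E') (a : E ⟶ X)
    (b : E' ⟶ X) (w : biprod.lift p q ≫ biprod.desc a (-b) = 0)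
    (hinj : ∀ v y, app p v y = 0 → app q v y = 0 → y = 0)
    (hsurj : ∀ v x, ∃ e e', app a v e - app b v e' = x)
    (hex : ∀ v e e', app a v e = app b v e' → ∃ y, app p v y = e ∧ app q v y = e') :
    (ShortComplex.mk (biprod.lift p q) (biprod.desc a (-b)) w).ShortExact := by
  have hp (v y) : app biprod.fst v (app (biprod.lift p q) v y) = app p v y := by
    rw [← app_comp, biprod.lift_fst]
  have hq (v y) : app biprod.snd v (app (biprod.lift p q) v y) = app q v y := by
    rw [← app_comp, biprod.lift_snd]
  have ha (v e) : app (biprod.desc a (-b)) v (app biprod.inl v e) = app a v e := by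
    rw [← app_comp, biprod.inl_desc]
  have hb (v e) : app (biprod.desc a (-b)) v (app biprod.inr v e) = -app b v e := by
    rw [← app_comp, biprod.inr_desc]; rfl
  refine shortExact_of_app (fun v ↦ ?_) (fun v x ↦ ?_) fun v x ↦ ⟨fun hx ↦ ?_, ?_⟩
  · refine (injective_iff_map_eq_zero _).2 fun y hy ↦ hinj v y ?_ ?_
    · rw [← hp, hy, map_zero]
    · rw [← hq, hy, map_zero]
  · obtain ⟨e, e', h⟩ := hsurj v x
    exact ⟨app biprod.inl v e + app biprod.inr v e', by rw [map_add, ha, hb, ← sub_eq_add_neg, h]⟩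
  · rw [← app_inl_add_app_inr v x, map_add, ha, hb, ← sub_eq_add_neg, sub_eq_zero] at hx
    obtain ⟨y, hy, hy'⟩ := hex v _ _ hx
    exact ⟨y, by rw [← app_inl_add_app_inr v (app _ v y), hp, hq, hy, hy', app_inl_add_app_inr]⟩
  · rintro ⟨y, rfl⟩
    rw [← app_comp, w, app_zero]

section ThinSquare

variable {Y E E' X : Set (Fin (n + 2))} {v : Fin (n + 2)}

lemma eq_zero_of_app_thinMap_eq_zero (hp : IsThinHom up Y E) (hq : IsThinHom up Y E')
    (hY : Y ⊆ E ∪ E') (y : (thin k up Y).Space v) (hpy : app (thinMap hp) v y = 0)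
    (hqy : app (thinMap hq) v y = 0) : y = 0 := by
  refine val_injective v ?_
  rw [map_zero]
  by_cases hv : v ∈ Y
  · rcases hY hv with hE | hE
    · simpa only [val_app_thinMap, if_pos hE, map_zero] using congrArg (val v) hpy
    · simpa only [val_app_thinMap, if_pos hE, map_zero] using congrArg (val v) hqy
  · exact val_eq_zero hv y

lemma exists_app_thinMap_sub_eq (ha : IsThinHom up E X) (hb : IsThinHom up E' X)
    (hX : X ⊆ E ∪ E') (x : (thin k up X).Space v) :
    ∃ e e', app (thinMap ha) v e - app (thinMap hb) v e' = x := by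
  by_cases hv : v ∈ X
  · rcases hX hv with hE | hE
    · refine ⟨val v x • unit v, 0, val_injective v ?_⟩
      rw [map_zero, sub_zero, val_app_thinMap, if_pos hv, map_smul, val_unit hE, smul_eq_mul,
        mul_one]
    · refine ⟨0, -val v x • unit v, val_injective v ?_⟩
      rw [map_zero, zero_sub, map_neg, val_app_thinMap, if_pos hv, map_smul, val_unit hE,
        smul_eq_mul, mul_one, neg_neg]
  · exact ⟨0, 0, (subsingleton_space_thin hv).elim _ _⟩

lemma exists_app_thinMap_eq_and_eq (hp : IsThinHom up Y E) (hq : IsThinHom up Y E')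
    (ha : IsThinHom up E X) (hb : IsThinHom up E' X) (hinter : E ∩ E' = Y ∩ X)
    (hunion : E ∪ E' = Y ∪ X) (e : (thin k up E).Space v) (e' : (thin k up E').Space v)
    (h : app (thinMap ha) v e = app (thinMap hb) v e') :
    ∃ y, app (thinMap hp) v y = e ∧ app (thinMap hq) v y = e' := by
  classical
  have hi := Set.ext_iff.1 hinter v
  have hu := Set.ext_iff.1 hunion v
  have hval := congrArg (val v) h
  rw [val_app_thinMap, val_app_thinMap] at hval
  have he := val_eq_zero (x := e)
  have he' := val_eq_zero (x := e')
  simp only [Set.mem_inter_iff, Set.mem_union] at hi hu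
  by_cases hv : v ∈ Y
  · refine ⟨(if v ∈ E then val v e else val v e') • unit v, val_injective v ?_, val_injective v ?_⟩
    all_goals
      rw [val_app_thinMap, map_smul, val_unit hv, smul_eq_mul, mul_one]
      grind
  · refine ⟨0, val_injective v ?_, val_injective v ?_⟩
    all_goals
      rw [map_zero, map_zero]
      grind

lemma exists_shortExact_thin (hp : IsThinHom up Y E) (hq : IsThinHom up Y E')
    (ha : IsThinHom up E X) (hb : IsThinHom up E' X) (hinter : E ∩ E' = Y ∩ X)
    (hunion : E ∪ E' = Y ∪ X) :
    ∃ (f : thin k up Y ⟶ thin k up E ⊞ thin k up E') (g : thin k up E ⊞ thin k up E' ⟶ thin k up X)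
      (w : f ≫ g = 0), (ShortComplex.mk f g w).ShortExact := by
  refine ⟨biprod.lift (thinMap hp) (thinMap hq), biprod.desc (thinMap ha) (-thinMap hb), ?_,
    shortExact_of_square _ _ _ _ _
      (fun _ ↦ eq_zero_of_app_thinMap_eq_zero hp hq (hunion.symm ▸ Set.subset_union_left))
      (fun _ ↦ exists_app_thinMap_sub_eq ha hb (hunion.symm ▸ Set.subset_union_right))
      fun _ ↦ exists_app_thinMap_eq_and_eq hp hq ha hb hinter hunion⟩
  rw [biprod.lift_desc, Preadditive.comp_neg, ← sub_eq_add_neg, sub_eq_zero]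
  refine hom_ext fun v y ↦ val_injective v ?_
  have hi := Set.ext_iff.1 hinter v
  have hu := Set.ext_iff.1 hunion v
  simp only [app_comp, val_app_thinMap, Set.mem_inter_iff, Set.mem_union] at hi hu ⊢
  have hy := val_eq_zero (x := y)
  grind

lemma exists_shortExact_thin_of_disjoint (hp : IsThinHom up Y E) (ha : IsThinHom up E X)
    (hYX : Disjoint Y X) (hE : E = Y ∪ X) :
    ∃ (f : thin k up Y ⟶ thin k up E) (g : thin k up E ⟶ thin k up X) (w : f ≫ g = 0),
      (ShortComplex.mk f g w).ShortExact := by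
  obtain ⟨f, g, w, hS⟩ := exists_shortExact_thin (k := k) (E' := ∅) hp
    (fun _ _ _ _ h ↦ h.elim) ha (fun _ _ _ h ↦ h.elim)
    (by rw [Set.inter_empty, hYX.inter_eq]) (by rw [Set.union_empty, hE])
  obtain ⟨e⟩ : Nonempty (thin k up E ≅ thin k up E ⊞ thin k up ∅) :=
    ⟨isoBiprodZero (isZero_iff_subsingleton.2 fun v ↦ subsingleton_space_thin (Set.notMem_empty v))⟩
  have w' : (f ≫ e.inv) ≫ e.hom ≫ g = 0 := by rw [Category.assoc, e.inv_hom_id_assoc, w]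
  exact ⟨_, _, w', ShortComplex.shortExact_of_iso (ShortComplex.isoMk (S₁ := .mk f g w)
    (S₂ := .mk _ _ w') (Iso.refl _) e.symm (Iso.refl _)) hS⟩

end ThinSquare

section Segments

variable {γ δ : PolygonSegment n}

lemma isEmpty_splitting_segmentRep {ε : PolygonSegment n} {X : TypeARep k up}
    {f : segmentRep k up γ ⟶ segmentRep k up ε} {g : segmentRep k up ε ⟶ X} {w : f ≫ g = 0}
    (h : γ ≠ ε) : IsEmpty (ShortComplex.mk f g w).Splitting :=
  ⟨fun s ↦ h (eq_of_retract_segmentRep ⟨f, s.r, s.f_r⟩)⟩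

lemma isEmpty_splitting_segmentRep_biprod {ε ε' : PolygonSegment n} {X : TypeARep k up}
    {f : segmentRep k up γ ⟶ segmentRep k up ε ⊞ segmentRep k up ε'}
    {g : segmentRep k up ε ⊞ segmentRep k up ε' ⟶ X} {w : f ≫ g = 0} (h : γ ≠ ε) (h' : γ ≠ ε') :
    IsEmpty (ShortComplex.mk f g w).Splitting :=
  ⟨fun s ↦ ((isBrick_segmentRep γ).nonempty_retract_of_retract_biprod ⟨f, s.r, s.f_r⟩).elim
    (fun ⟨r⟩ ↦ h (eq_of_retract_segmentRep r)) fun ⟨r⟩ ↦ h' (eq_of_retract_segmentRep r)⟩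

lemma isThinHom_support (h₁ : γ.1.1 < δ.1.1 → δ.1.1.val ∉ upperVertices up)
    (h₂ : δ.1.1 < γ.1.1 → γ.1.1.val ∈ upperVertices up)
    (h₃ : γ.1.2 < δ.1.2 → γ.1.2.val ∉ upperVertices up)
    (h₄ : δ.1.2 < γ.1.2 → δ.1.2.val ∈ upperVertices up) :
    IsThinHom up γ.support δ.support := fun s t e ↦ by
  have := mem_upperVertices_of_arrow e
  simp only [PolygonSegment.mem_support]
  grind

lemma exists_shortExact_of_crossesUpward (h : γ.CrossesUpward up δ) (h₁ : δ.1.1 < γ.1.2)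
    (h₂ : γ.1.1 < δ.1.2) :
    ∃ (f : segmentRep k up γ ⟶
        segmentRep k up ⟨(δ.1.1, γ.1.2), h₁⟩ ⊞ segmentRep k up ⟨(γ.1.1, δ.1.2), h₂⟩)
      (g : segmentRep k up ⟨(δ.1.1, γ.1.2), h₁⟩ ⊞ segmentRep k up ⟨(γ.1.1, δ.1.2), h₂⟩ ⟶
        segmentRep k up δ) (w : f ≫ g = 0),
      (ShortComplex.mk f g w).ShortExact ∧ IsEmpty (ShortComplex.mk f g w).Splitting := by
  obtain ⟨⟨i, j⟩, hij⟩ := γ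
  obtain ⟨⟨i', j'⟩, hij'⟩ := δ
  simp only [PolygonSegment.CrossesUpward, CrossesUpward] at h
  obtain ⟨f, g, w, hS⟩ := exists_shortExact_thin (k := k) (up := up)
    (Y := PolygonSegment.support ⟨(i, j), hij⟩) (E := PolygonSegment.support ⟨(i', j), h₁⟩)
    (E' := PolygonSegment.support ⟨(i, j'), h₂⟩) (X := PolygonSegment.support ⟨(i', j'), hij'⟩)
    (by apply isThinHom_support <;> grind) (by apply isThinHom_support <;> grind)
    (by apply isThinHom_support <;> grind) (by apply isThinHom_support <;> grind)
    (by ext; simp only [Set.mem_inter_iff, PolygonSegment.mem_support]; grind)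
    (by ext; simp only [Set.mem_union, PolygonSegment.mem_support]; grind)
  exact ⟨f, g, w, hS, isEmpty_splitting_segmentRep_biprod (by grind) (by grind)⟩

lemma exists_shortExact_of_abutsUpward (h : γ.AbutsUpward up δ) :
    ∃ (ε : PolygonSegment n) (f : segmentRep k up γ ⟶ segmentRep k up ε)
      (g : segmentRep k up ε ⟶ segmentRep k up δ) (w : f ≫ g = 0),
      (ShortComplex.mk f g w).ShortExact ∧ IsEmpty (ShortComplex.mk f g w).Splitting ∧
      Subsingleton (Abelian.Ext (segmentRep k up ε) (segmentRep k up γ) 1) := by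
  obtain ⟨⟨i, j⟩, hij⟩ := γ
  obtain ⟨⟨i', j'⟩, hij'⟩ := δ
  simp only [PolygonSegment.AbutsUpward] at h hij hij'
  have hlt : min i i' < max j j' := (min_le_left i i').trans_lt (hij.trans_le (le_max_left j j'))
  obtain ⟨f, g, w, hS⟩ := exists_shortExact_thin_of_disjoint (k := k) (up := up)
    (Y := PolygonSegment.support ⟨(i, j), hij⟩)
    (E := PolygonSegment.support ⟨(min i i', max j j'), hlt⟩)
    (X := PolygonSegment.support ⟨(i', j'), hij'⟩)
    (by apply isThinHom_support <;> grind) (by apply isThinHom_support <;> grind)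
    (Set.disjoint_left.2 fun v ↦ by simp only [PolygonSegment.mem_support]; grind)
    (by ext v; simp only [Set.mem_union, PolygonSegment.mem_support]; grind)
  refine ⟨⟨(min i i', max j j'), hlt⟩, f, g, w, hS, isEmpty_splitting_segmentRep ?_,
    subsingleton_ext_segmentRep ?_ ?_⟩
  · grind
  · grind [PolygonSegment.CrossesUpward, CrossesUpward]
  · grind [PolygonSegment.AbutsUpward]

/-- The condition on a pair of indecomposable summands of an almost rigid representation. -/
def ExtCompatible (A B : TypeARep k up) : Prop :=
  Subsingleton (Abelian.Ext A B 1) ∨ ExtGeneratedByIndecomposable A B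

lemma extGeneratedByIndecomposable_of_abutsUpward {A B : TypeARep k up}
    (eA : A ≅ segmentRep k up γ) (eB : B ≅ segmentRep k up δ) (h : δ.AbutsUpward up γ) :
    ExtGeneratedByIndecomposable A B := by
  obtain ⟨ε, f, g, w, hS, hsplit, hext⟩ := exists_shortExact_of_abutsUpward (k := k) h
  have w' : (eB.hom ≫ f) ≫ g ≫ eA.inv = 0 := by
    rw [Category.assoc, ← Category.assoc f, w, zero_comp, comp_zero]
  let e : ShortComplex.mk f g w ≅ ShortComplex.mk (eB.hom ≫ f) (g ≫ eA.inv) w' :=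
    ShortComplex.isoMk eB.symm (Iso.refl _) eA.symm
  have hS' := ShortComplex.shortExact_of_iso e hS
  have hsplit' : IsEmpty (ShortComplex.mk (eB.hom ≫ f) (g ≫ eA.inv) w').Splitting :=
    ⟨fun s ↦ hsplit.false (s.ofIso e.symm)⟩
  have hB : IsBrick k B := (isBrick_segmentRep δ).of_iso eB.symm
  have hextB : Subsingleton (Abelian.Ext (segmentRep k up ε) B 1) :=
    subsingleton_ext_of_iso (Iso.refl _) eB 1
  exact ⟨finrank_ext_eq_one hS' hsplit' hB, _, _, _, _, hS', indecomposable_segmentRep ε,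
    span_extClass_eq_top hS' hB⟩

lemma extCompatible_of_not_crossesUpward {A B : TypeARep k up} (eA : A ≅ segmentRep k up γ)
    (eB : B ≅ segmentRep k up δ) (h : ¬ δ.CrossesUpward up γ) : ExtCompatible A B := by
  by_cases h' : δ.AbutsUpward up γ
  · exact .inr (extGeneratedByIndecomposable_of_abutsUpward eA eB h')
  · have := subsingleton_ext_segmentRep (k := k) h h'
    exact .inl (subsingleton_ext_of_iso eA eB 1)

/- The middle term of an extension has dimension two where the supports overlap. -/
lemma disjoint_support_of_extGeneratedByIndecomposable
    (h : ExtGeneratedByIndecomposable (segmentRep k up γ) (segmentRep k up δ)) :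
    Disjoint γ.support δ.support := by
  obtain ⟨-, E, f, g, w, hS, hE, -⟩ := h
  obtain ⟨ε, ⟨e⟩⟩ := exists_iso_segmentRep hE
  refine Set.disjoint_left.2 fun v hγ hδ ↦ ?_
  have hdim := finrank_of_shortExact hS v
  rw [finrank_eq_of_iso e, finrank_thin_of_mem hγ, finrank_thin_of_mem hδ] at hdim
  exact absurd (finrank_thin_le_one (k := k) (up := up) (S := ε.support) (v := v)) (by lia)

lemma not_extCompatible_of_crossesUpward (h : δ.CrossesUpward up γ) :
    ¬ ExtCompatible (segmentRep k up γ) (segmentRep k up δ) := by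
  have hlt := h.1
  rintro (hsub | hgen)
  · obtain ⟨f, g, w, hS, hsplit⟩ := exists_shortExact_of_crossesUpward (k := k) h
      (Fin.lt_def.2 (by lia)) (Fin.lt_def.2 (by lia))
    exact (nonempty_splitting_of_subsingleton_ext hS).elim hsplit.false
  · have hdisj := disjoint_support_of_extGeneratedByIndecomposable hgen
    let v : Fin (n + 2) := ⟨max δ.1.1 γ.1.1, by lia⟩
    have hγ : v ∈ γ.support := PolygonSegment.mem_support.2 (by lia)
    have hδ : v ∈ δ.support := PolygonSegment.mem_support.2 (by lia)
    exact Set.disjoint_left.1 hdisj hγ hδ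

end Segments

end TypeARep

/-! ### Summands -/

namespace TypeARep

variable {k : Type u} [Field k] {n : ℕ} {up : Fin (n + 1) → Bool} {X Y T : TypeARep k up}
  {γ : PolygonSegment n}

lemma isSummand_iff : IsSummand X T ↔ Nonempty (Retract X T) :=
  ⟨fun ⟨_, ⟨e⟩⟩ ↦ ⟨⟨biprod.inl ≫ e.inv, e.hom ≫ biprod.fst, by simp⟩⟩,
    fun ⟨h⟩ ↦ ⟨_, nonempty_iso_biprod_cokernel h⟩⟩

lemma IsSummand.trans (h : IsSummand X Y) (h' : IsSummand Y T) : IsSummand X T := by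
  obtain ⟨r⟩ := isSummand_iff.1 h
  obtain ⟨r'⟩ := isSummand_iff.1 h'
  exact isSummand_iff.2 ⟨r.trans r'⟩

lemma IsSummand.of_iso (e : X ≅ T) : IsSummand X T :=
  isSummand_iff.2 ⟨.ofIso e⟩

lemma isSummand_biprod_left (X Y : TypeARep k up) : IsSummand X (X ⊞ Y) :=
  ⟨Y, ⟨Iso.refl _⟩⟩

lemma isSummand_biprod_right (X Y : TypeARep k up) : IsSummand Y (X ⊞ Y) :=
  ⟨X, ⟨biprod.braiding _ _⟩⟩

lemma IsSummand.biprod {X' Y' : TypeARep k up} (h : IsSummand X Y) (h' : IsSummand X' Y') :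
    IsSummand (X ⊞ X') (Y ⊞ Y') := by
  obtain ⟨r⟩ := isSummand_iff.1 h
  obtain ⟨r'⟩ := isSummand_iff.1 h'
  exact isSummand_iff.2
    ⟨⟨biprod.map r.i r'.i, biprod.map r.r r'.r, by apply biprod.hom_ext' <;> simp⟩⟩

lemma IsBasic.of_isSummand (hT : IsBasic T) (h : IsSummand X T) : IsBasic X :=
  fun A hA hX ↦ hT A hA (hX.trans h)

/-- The line segments whose indecomposable representations are summands of `T`; a basic
representation is determined by them. -/
def segments (T : TypeARep k up) : Set (PolygonSegment n) :=
  {γ | IsSummand (segmentRep k up γ) T}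

lemma mem_segments_iff : γ ∈ segments T ↔ Nonempty (Retract (segmentRep k up γ) T) :=
  isSummand_iff

lemma IsSummand.segments_subset (h : IsSummand X T) : segments X ⊆ segments T :=
  fun _ hγ ↦ IsSummand.trans hγ h

lemma segments_eq_of_iso (e : X ≅ T) : segments X = segments T :=
  (IsSummand.of_iso e).segments_subset.antisymm (IsSummand.of_iso e.symm).segments_subset

lemma segments_biprod (X Y : TypeARep k up) : segments (X ⊞ Y) = segments X ∪ segments Y := by
  refine Set.Subset.antisymm (fun γ hγ ↦ ?_) (Set.union_subset
    (isSummand_biprod_left X Y).segments_subset (isSummand_biprod_right X Y).segments_subset)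
  obtain ⟨h⟩ := mem_segments_iff.1 hγ
  exact ((isBrick_segmentRep γ).nonempty_retract_of_retract_biprod h).imp
    mem_segments_iff.2 mem_segments_iff.2

lemma segments_segmentRep (γ : PolygonSegment n) : segments (segmentRep k up γ) = {γ} := by
  refine Set.Subset.antisymm (fun δ hδ ↦ ?_)
    (Set.singleton_subset_iff.2 (IsSummand.of_iso (Iso.refl _)))
  obtain ⟨h⟩ := mem_segments_iff.1 hδ
  exact eq_of_retract_segmentRep h

lemma segments_eq_empty_iff : segments T = ∅ ↔ IsZero T := by
  refine ⟨fun h ↦ ?_, fun hT ↦ Set.eq_empty_of_forall_notMem fun γ hγ ↦ ?_⟩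
  · by_contra hT
    obtain ⟨γ, hγ⟩ := exists_retract_segmentRep hT
    exact (h ▸ mem_segments_iff.2 hγ : γ ∈ (∅ : Set _))
  · obtain ⟨r⟩ := mem_segments_iff.1 hγ
    exact (isBrick_segmentRep (k := k) (up := up) γ).1 (hT.of_mono r.i)

lemma isBasic_iff :
    IsBasic T ↔ ∀ γ, ¬ IsSummand (segmentRep k up γ ⊞ segmentRep k up γ) T := by
  refine ⟨fun hT γ ↦ hT _ (indecomposable_segmentRep γ), fun hT X hX hXT ↦ ?_⟩
  obtain ⟨γ, ⟨e⟩⟩ := exists_iso_segmentRep hX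
  exact hT γ ((IsSummand.of_iso (biprod.mapIso e.symm e.symm)).trans hXT)

lemma isBasic_of_isZero (hT : IsZero T) : IsBasic T := isBasic_iff.2 fun γ hγ ↦ by
  have hmem : γ ∈ segments T := (isSummand_biprod_left _ _).trans hγ
  exact (segments_eq_empty_iff.2 hT ▸ hmem : γ ∈ (∅ : Set _))

lemma IsBasic.disjoint_segments (h : IsBasic (X ⊞ Y)) : Disjoint (segments X) (segments Y) :=
  Set.disjoint_left.2 fun γ hX hY ↦ isBasic_iff.1 h γ (hX.biprod hY)

lemma IsBasic.segmentRep_biprod (hY : IsBasic Y) (hγ : γ ∉ segments Y) :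
    IsBasic (segmentRep k up γ ⊞ Y) := by
  refine isBasic_iff.2 fun δ hδ ↦ ?_
  obtain ⟨h⟩ := isSummand_iff.1 hδ
  obtain rfl | hne := eq_or_ne δ γ
  · have hempty := not_nonempty_iff.1 (mem_segments_iff.not.1 hγ)
    exact ((isBrick_segmentRep δ).isEmpty_retract_biprod_self hempty).false h
  · have hempty : IsEmpty (Retract (segmentRep k up δ) (segmentRep k up γ)) :=
      ⟨fun r ↦ hne (eq_of_retract_segmentRep r)⟩
    exact isBasic_iff.1 hY δ (isSummand_iff.2
      ((isBrick_segmentRep δ).nonempty_retract_of_retract_biprod_self hempty h))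

lemma exists_iso_biprod_of_mem_segments (hT : IsBasic T) (hγ : γ ∈ segments T) :
    ∃ R : TypeARep k up, Nonempty (T ≅ segmentRep k up γ ⊞ R) ∧ IsBasic R ∧
      segments R = segments T \ {γ} := by
  obtain ⟨R, ⟨e⟩⟩ := hγ
  have hbasic := hT.of_isSummand (IsSummand.of_iso e.symm)
  have hdisj := hbasic.disjoint_segments
  rw [segments_segmentRep, Set.disjoint_singleton_left] at hdisj
  refine ⟨R, ⟨e⟩, hbasic.of_isSummand (isSummand_biprod_right _ _), ?_⟩
  rw [segments_eq_of_iso e, segments_biprod, segments_segmentRep, Set.union_sdiff_left,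
    Set.sdiff_singleton_eq_self hdisj]

lemma nonempty_iso_of_segments_eq {T₁ T₂ : TypeARep k up} (h₁ : IsBasic T₁) (h₂ : IsBasic T₂)
    (h : segments T₁ = segments T₂) : Nonempty (T₁ ≅ T₂) := by
  generalize hS : segments T₁ = S at h
  induction S, S.toFinite using Set.Finite.induction_on generalizing T₁ T₂ with
  | empty => exact ⟨(segments_eq_empty_iff.1 hS).iso (segments_eq_empty_iff.1 h.symm)⟩
  | @insert γ S hγ _ ih =>
    obtain ⟨R₁, ⟨e₁⟩, hb₁, hR₁⟩ := exists_iso_biprod_of_mem_segments h₁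
      (hS ▸ Set.mem_insert γ S : γ ∈ segments T₁)
    obtain ⟨R₂, ⟨e₂⟩, hb₂, hR₂⟩ := exists_iso_biprod_of_mem_segments h₂
      (h ▸ Set.mem_insert γ S : γ ∈ segments T₂)
    rw [hS, Set.insert_sdiff_self_of_notMem hγ] at hR₁
    rw [← h, Set.insert_sdiff_self_of_notMem hγ] at hR₂
    obtain ⟨e⟩ := ih hb₁ hb₂ hR₁ hR₂.symm
    exact ⟨e₁ ≪≫ biprod.mapIso (Iso.refl _) e ≪≫ e₂.symm⟩

variable (k up) in
lemma exists_isBasic_segments_eq (S : Set (PolygonSegment n)) :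
    ∃ T : TypeARep k up, IsBasic T ∧ segments T = S := by
  induction S, S.toFinite using Set.Finite.induction_on with
  | empty =>
    obtain ⟨Z, hZ⟩ := HasZeroObject.zero (C := TypeARep k up)
    exact ⟨Z, isBasic_of_isZero hZ, segments_eq_empty_iff.2 hZ⟩
  | @insert γ S hγ _ ih =>
    obtain ⟨R, hb, hR⟩ := ih
    refine ⟨segmentRep k up γ ⊞ R, hb.segmentRep_biprod (hR ▸ hγ), ?_⟩
    rw [segments_biprod, segments_segmentRep, hR, Set.singleton_union]

end TypeARep

/-! ### Almost rigid representations as non-crossing sets of segments -/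

/-- The combinatorial form of the condition that no two line segments of a set cross: the slopes of
two crossing segments differ, so that one of them crosses the other one upward. -/
def NonCrossing {n : ℕ} (up : Fin (n + 1) → Bool) (S : Set (PolygonSegment n)) : Prop :=
  ∀ γ ∈ S, ∀ δ ∈ S, ¬ γ.CrossesUpward up δ

lemma NonCrossing.mono {n : ℕ} {up : Fin (n + 1) → Bool} {S S' : Set (PolygonSegment n)}
    (h : NonCrossing up S') (hS : S ⊆ S') : NonCrossing up S :=
  fun γ hγ δ hδ ↦ h γ (hS hγ) δ (hS hδ)

namespace TypeARep

variable {k : Type u} [Field k] {n : ℕ} {up : Fin (n + 1) → Bool} {T : TypeARep k up}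

lemma isAlmostRigid_iff : IsAlmostRigid T ↔ IsBasic T ∧ NonCrossing up (segments T) := by
  refine and_congr_right fun _ ↦ ⟨fun h γ hγ δ hδ hc ↦ ?_, fun h A B hA hB hAT hBT ↦ ?_⟩
  · exact not_extCompatible_of_crossesUpward (k := k) hc
      (h _ _ (indecomposable_segmentRep δ) (indecomposable_segmentRep γ) hδ hγ)
  · obtain ⟨γ, ⟨eA⟩⟩ := exists_iso_segmentRep hA
    obtain ⟨δ, ⟨eB⟩⟩ := exists_iso_segmentRep hB
    exact extCompatible_of_not_crossesUpward eA eB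
      (h δ ((IsSummand.of_iso eB.symm).trans hBT) γ ((IsSummand.of_iso eA.symm).trans hAT))

lemma isMaximalAlmostRigid_iff :
    IsMaximalAlmostRigid T ↔ IsBasic T ∧ Maximal (NonCrossing up) (segments T) := by
  rw [IsMaximalAlmostRigid, isAlmostRigid_iff, and_assoc]
  refine and_congr_right fun hb ↦ and_congr_right fun _ ↦ ⟨fun h S hS hTS γ hγ ↦ ?_,
    fun h M hM hTM ↦ ?_⟩
  · by_contra hγT
    refine h (segmentRep k up γ) (isBrick_segmentRep (k := k) γ).1 (isAlmostRigid_iff.2 ⟨?_, ?_⟩)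
    · exact (hb.segmentRep_biprod hγT).of_isSummand (IsSummand.of_iso (biprod.braiding _ _))
    · rw [segments_biprod, segments_segmentRep]
      exact NonCrossing.mono hS (Set.union_subset hTS (Set.singleton_subset_iff.2 hγ))
  · obtain ⟨hb', hS⟩ := isAlmostRigid_iff.1 hTM
    rw [segments_biprod] at hS
    obtain ⟨γ, hr⟩ := exists_retract_segmentRep hM
    have hγM : γ ∈ segments M := mem_segments_iff.2 hr
    exact Set.disjoint_left.1 hb'.disjoint_segments (h hS Set.subset_union_left (Or.inr hγM)) hγM

end TypeARep

/-! ### Crossings and slopes -/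

/-- The second coordinate of the point with first coordinate `x` on the line through `a` and `b`,
which must not be vertical. -/
noncomputable def lineHeight (a b : ℝ × ℝ) (x : ℝ) : ℝ :=
  a.2 + (b.2 - a.2) / (b.1 - a.1) * (x - a.1)

lemma mem_openSegment_iff_lineHeight {a b q : ℝ × ℝ} (h : a.1 < b.1) :
    q ∈ openSegment ℝ a b ↔ q.1 ∈ Set.Ioo a.1 b.1 ∧ q.2 = lineHeight a b q.1 := by
  have hpos : 0 < b.1 - a.1 := sub_pos.2 h
  rw [openSegment_eq_image', lineHeight]
  constructor
  · rintro ⟨θ, ⟨hθ, hθ'⟩, rfl⟩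
    simp only [Prod.fst_add, Prod.smul_fst, Prod.fst_sub, Prod.snd_add, Prod.smul_snd,
      Prod.snd_sub, smul_eq_mul, Set.mem_Ioo]
    exact ⟨⟨by nlinarith, by nlinarith⟩, by field_simp; ring⟩
  · rintro ⟨⟨hq, hq'⟩, hheight⟩
    refine ⟨(q.1 - a.1) / (b.1 - a.1), ⟨by apply div_pos <;> linarith, ?_⟩, Prod.ext ?_ ?_⟩
    · rw [div_lt_one hpos]
      linarith
    · simp only [Prod.fst_add, Prod.smul_fst, Prod.fst_sub, smul_eq_mul]
      field_simp
      ring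
    · simp only [Prod.snd_add, Prod.smul_snd, Prod.snd_sub, smul_eq_mul, hheight]
      ring

lemma mem_convexHull_of_mem_uIcc_lineHeight {a b c d p : ℝ × ℝ} (hab : p.1 ∈ Set.Ioo a.1 b.1)
    (hcd : p.1 ∈ Set.Ioo c.1 d.1)
    (h : p.2 ∈ Set.uIcc (lineHeight a b p.1) (lineHeight c d p.1)) :
    p ∈ convexHull ℝ {a, b, c, d} := by
  have hconv := convex_convexHull ℝ ({a, b, c, d} : Set (ℝ × ℝ))
  have hsub := subset_convexHull ℝ ({a, b, c, d} : Set (ℝ × ℝ))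
  have mem_chord {u v : ℝ × ℝ} (hu : u ∈ convexHull ℝ {a, b, c, d})
      (hv : v ∈ convexHull ℝ {a, b, c, d}) (huv : p.1 ∈ Set.Ioo u.1 v.1) :
      (p.1, lineHeight u v p.1) ∈ convexHull ℝ {a, b, c, d} :=
    hconv.openSegment_subset hu hv
      ((mem_openSegment_iff_lineHeight (huv.1.trans huv.2)).2 ⟨huv, rfl⟩)
  refine hconv.segment_subset (mem_chord (hsub (by simp)) (hsub (by simp)) hab)
    (mem_chord (hsub (by simp)) (hsub (by simp)) hcd) ?_
  rw [← Prod.image_mk_segment_right, segment_eq_uIcc]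
  exact ⟨p.2, h, rfl⟩

namespace PolygonDrawing

variable {n : ℕ} {up : Fin (n + 1) → Bool} {γ δ : PolygonSegment n}

/-- The second coordinate, at `x`, of the line through the end points of a segment. -/
noncomputable def lineAt (P : PolygonDrawing up) (γ : PolygonSegment n) (x : ℝ) : ℝ :=
  lineHeight (P.pt γ.1.1) (P.pt γ.1.2) x

variable {P : PolygonDrawing up}

lemma fst_lt_fst (γ : PolygonSegment n) : (P.pt γ.1.1).1 < (P.pt γ.1.2).1 := P.strictMono_fst γ.2

lemma lineAt_eq_add_slope_mul (γ : PolygonSegment n) (x y : ℝ) :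
    P.lineAt γ x = P.lineAt γ y + P.slope γ * (x - y) := by
  rw [lineAt, lineAt, lineHeight, lineHeight, slope]
  ring

lemma lineAt_left (γ : PolygonSegment n) : P.lineAt γ (P.pt γ.1.1).1 = (P.pt γ.1.1).2 := by
  rw [lineAt, lineHeight, sub_self, mul_zero, add_zero]

lemma lineAt_right (γ : PolygonSegment n) : P.lineAt γ (P.pt γ.1.2).1 = (P.pt γ.1.2).2 := by
  rw [lineAt, lineHeight, div_mul_cancel₀ _ (sub_pos.2 (fst_lt_fst γ)).ne', add_sub_cancel]

lemma snd_notMem_uIcc_lineAt {m : Fin (n + 3)} (h₁ : γ.1.1 < m) (h₂ : m < γ.1.2) :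
    (P.pt m).2 ∉ Set.uIcc (P.pt 0).2 (P.lineAt γ (P.pt m).1) := fun h ↦ by
  have h0 : 0 < m := (Fin.zero_le _).trans_lt h₁
  have hlast : m < Fin.last (n + 2) := h₂.trans_le (Fin.le_last _)
  have hbase : lineHeight (P.pt 0) (P.pt (Fin.last (n + 2))) (P.pt m).1 = (P.pt 0).2 := by
    rw [lineHeight, P.snd_last, sub_self, zero_div, zero_mul, add_zero]
  have hmem : P.pt m ∈ convexHull ℝ (P.pt '' {0, Fin.last (n + 2), γ.1.1, γ.1.2}) := by
    simp only [Set.image_insert_eq, Set.image_singleton]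
    exact mem_convexHull_of_mem_uIcc_lineHeight
      ⟨P.strictMono_fst h0, P.strictMono_fst hlast⟩
      ⟨P.strictMono_fst h₁, P.strictMono_fst h₂⟩ (hbase.symm ▸ h)
  rcases (P.convexIndependent.mem_convexHull_iff _ _).1 hmem with rfl | rfl | rfl | rfl
  exacts [h0.false, hlast.false, h₁.false, h₂.false]

lemma lineAt_lt_snd_of_mem {m : Fin (n + 3)} (h₁ : γ.1.1 < m) (h₂ : m < γ.1.2)
    (hm : m.val ∈ upperVertices up) : P.lineAt γ (P.pt m).1 < (P.pt m).2 := by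
  obtain ⟨a, ha, hup⟩ := hm
  obtain rfl : a.castSucc.succ = m := Fin.ext ha
  by_contra! hle
  exact snd_notMem_uIcc_lineAt h₁ h₂ (Set.Icc_subset_uIcc ⟨(P.above a hup).le, hle⟩)

lemma snd_lt_lineAt_of_notMem {m : Fin (n + 3)} (h₁ : γ.1.1 < m) (h₂ : m < γ.1.2)
    (hm : m.val ∉ upperVertices up) : (P.pt m).2 < P.lineAt γ (P.pt m).1 := by
  obtain ⟨a, rfl⟩ : ∃ a : Fin (n + 1), a.castSucc.succ = m :=
    ⟨⟨m - 1, by lia⟩, Fin.ext (by simp only [Fin.castSucc_mk, Fin.succ_mk]; lia)⟩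
  have hup : up a = false := Bool.eq_false_iff.2 fun hup ↦ hm ⟨a, rfl, hup⟩
  by_contra! hle
  exact snd_notMem_uIcc_lineAt h₁ h₂ (Set.Icc_subset_uIcc' ⟨hle, (P.below a hup).le⟩)

lemma lineAt_lt_snd_iff {m : Fin (n + 3)} (h₁ : γ.1.1 < m) (h₂ : m < γ.1.2) :
    P.lineAt γ (P.pt m).1 < (P.pt m).2 ↔ m.val ∈ upperVertices up :=
  ⟨fun h ↦ by_contra fun hm ↦ h.not_gt (snd_lt_lineAt_of_notMem h₁ h₂ hm),
    lineAt_lt_snd_of_mem h₁ h₂⟩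

lemma snd_lt_lineAt_iff {m : Fin (n + 3)} (h₁ : γ.1.1 < m) (h₂ : m < γ.1.2) :
    (P.pt m).2 < P.lineAt γ (P.pt m).1 ↔ m.val ∉ upperVertices up :=
  ⟨fun h hm ↦ h.not_gt (lineAt_lt_snd_of_mem h₁ h₂ hm), snd_lt_lineAt_of_notMem h₁ h₂⟩

lemma lineAt_lt_lineAt_max_iff (h : max γ.1.1 δ.1.1 < min γ.1.2 δ.1.2) :
    P.lineAt δ (P.pt (max γ.1.1 δ.1.1)).1 < P.lineAt γ (P.pt (max γ.1.1 δ.1.1)).1 ↔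
      γ.1.1 < δ.1.1 ∧ δ.1.1.val ∉ upperVertices up ∨
        δ.1.1 < γ.1.1 ∧ γ.1.1.val ∈ upperVertices up := by
  obtain ⟨hγ, hδ⟩ := lt_min_iff.1 h
  rcases lt_trichotomy γ.1.1 δ.1.1 with hlt | heq | hlt
  · rw [max_eq_right hlt.le] at hγ ⊢
    rw [lineAt_left, snd_lt_lineAt_iff hlt hγ]
    simp only [hlt, hlt.not_gt, true_and, false_and, or_false]
  · rw [heq, max_self, lineAt_left δ, ← heq, lineAt_left γ]
    simp only [lt_irrefl, false_and, or_self]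
  · rw [max_eq_left hlt.le] at hδ ⊢
    rw [lineAt_left, lineAt_lt_snd_iff hlt hδ]
    simp only [hlt, hlt.not_gt, true_and, false_and, false_or]

lemma lineAt_lt_lineAt_min_iff (h : max γ.1.1 δ.1.1 < min γ.1.2 δ.1.2) :
    P.lineAt γ (P.pt (min γ.1.2 δ.1.2)).1 < P.lineAt δ (P.pt (min γ.1.2 δ.1.2)).1 ↔
      γ.1.2 < δ.1.2 ∧ γ.1.2.val ∉ upperVertices up ∨
        δ.1.2 < γ.1.2 ∧ δ.1.2.val ∈ upperVertices up := by
  obtain ⟨hγ, hδ⟩ := max_lt_iff.1 h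
  rcases lt_trichotomy γ.1.2 δ.1.2 with hlt | heq | hlt
  · rw [min_eq_left hlt.le] at hδ ⊢
    rw [lineAt_right, snd_lt_lineAt_iff hδ hlt]
    simp only [hlt, hlt.not_gt, true_and, false_and, or_false]
  · rw [heq, min_self, lineAt_right δ, ← heq, lineAt_right γ]
    simp only [lt_irrefl, false_and, or_self]
  · rw [min_eq_right hlt.le] at hγ ⊢
    rw [lineAt_right, lineAt_lt_snd_iff hγ hlt]
    simp only [hlt, hlt.not_gt, true_and, false_and, false_or]

lemma crossesUpward_iff_lineAt : γ.CrossesUpward up δ ↔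
    max γ.1.1 δ.1.1 < min γ.1.2 δ.1.2 ∧
      P.lineAt δ (P.pt (max γ.1.1 δ.1.1)).1 < P.lineAt γ (P.pt (max γ.1.1 δ.1.1)).1 ∧
      P.lineAt γ (P.pt (min γ.1.2 δ.1.2)).1 < P.lineAt δ (P.pt (min γ.1.2 δ.1.2)).1 := by
  have hov : max γ.1.1.val δ.1.1 < min γ.1.2.val δ.1.2 ↔ max γ.1.1 δ.1.1 < min γ.1.2 δ.1.2 := by
    simp only [Fin.lt_def, max_lt_iff, lt_min_iff]
  rw [PolygonSegment.CrossesUpward, _root_.CrossesUpward, hov]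
  refine and_congr_right fun h ↦ ?_
  rw [lineAt_lt_lineAt_max_iff h, lineAt_lt_lineAt_min_iff h]
  rfl

lemma cross_iff_exists_lineAt_eq : P.Cross γ δ ↔ γ ≠ δ ∧
    ∃ x ∈ Set.Ioo (P.pt (max γ.1.1 δ.1.1)).1 (P.pt (min γ.1.2 δ.1.2)).1,
      P.lineAt γ x = P.lineAt δ x := by
  have hmem (x : ℝ) : x ∈ Set.Ioo (P.pt (max γ.1.1 δ.1.1)).1 (P.pt (min γ.1.2 δ.1.2)).1 ↔
      x ∈ Set.Ioo (P.pt γ.1.1).1 (P.pt γ.1.2).1 ∧ x ∈ Set.Ioo (P.pt δ.1.1).1 (P.pt δ.1.2).1 := by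
    rw [P.strictMono_fst.monotone.map_max, P.strictMono_fst.monotone.map_min,
      ← Set.Ioo_inter_Ioo, Set.mem_inter_iff]
  refine and_congr_right fun _ ↦ ?_
  simp only [Set.Nonempty, Set.mem_inter_iff, mem_openSegment_iff_lineHeight (fst_lt_fst _), hmem]
  exact ⟨fun ⟨q, ⟨hγ, hq⟩, hδ, hq'⟩ ↦ ⟨q.1, ⟨hγ, hδ⟩, hq.symm.trans hq'⟩,
    fun ⟨x, ⟨hγ, hδ⟩, h⟩ ↦ ⟨(x, P.lineAt γ x), ⟨hγ, rfl⟩, hδ, h⟩⟩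

lemma Cross.max_lt_min (h : P.Cross γ δ) : max γ.1.1 δ.1.1 < min γ.1.2 δ.1.2 := by
  obtain ⟨-, x, hx, -⟩ := cross_iff_exists_lineAt_eq.1 h
  exact P.strictMono_fst.lt_iff_lt.1 (hx.1.trans hx.2)

lemma Cross.symm (h : P.Cross γ δ) : P.Cross δ γ :=
  ⟨h.1.symm, by rw [Set.inter_comm]; exact h.2⟩

lemma Cross.slope_ne (h : P.Cross γ δ) : P.slope γ ≠ P.slope δ := fun hs ↦ by
  obtain ⟨hne, x, -, hx⟩ := cross_iff_exists_lineAt_eq.1 h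
  have heq (y : ℝ) : P.lineAt γ y = P.lineAt δ y := by
    rw [lineAt_eq_add_slope_mul γ y x, lineAt_eq_add_slope_mul δ y x, hx, hs]
  have hl := mt (lineAt_lt_lineAt_max_iff (P := P) h.max_lt_min).2 (heq _).not_gt
  have hl' := mt (lineAt_lt_lineAt_max_iff (P := P) h.symm.max_lt_min).2 (heq _).not_lt
  have hr := mt (lineAt_lt_lineAt_min_iff (P := P) h.max_lt_min).2 (heq _).not_lt
  have hr' := mt (lineAt_lt_lineAt_min_iff (P := P) h.symm.max_lt_min).2 (heq _).not_gt
  exact hne (Subtype.ext (Prod.ext (by grind) (by grind)))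

theorem crossesUpward_iff :
    γ.CrossesUpward up δ ↔ P.Cross γ δ ∧ P.slope γ < P.slope δ := by
  constructor
  · intro h
    obtain ⟨hlt, hl, hr⟩ := (crossesUpward_iff_lineAt (P := P)).1 h
    have hx := P.strictMono_fst hlt
    have hcont : Continuous fun x ↦ P.lineAt γ x - P.lineAt δ x := by
      unfold lineAt lineHeight
      fun_prop
    obtain ⟨x, hx', hx0⟩ :=
      intermediate_value_Ioo' hx.le hcont.continuousOn ⟨sub_neg.2 hr, sub_pos.2 hl⟩
    refine ⟨cross_iff_exists_lineAt_eq.2 ⟨?_, x, hx', sub_eq_zero.1 hx0⟩, ?_⟩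
    · rintro rfl
      exact hl.false
    · rw [lineAt_eq_add_slope_mul γ _ (P.pt (max γ.1.1 δ.1.1)).1,
        lineAt_eq_add_slope_mul δ _ (P.pt (max γ.1.1 δ.1.1)).1] at hr
      nlinarith
  · rintro ⟨h, hs⟩
    obtain ⟨-, x, ⟨hx, hx'⟩, heq⟩ := cross_iff_exists_lineAt_eq.1 h
    refine (crossesUpward_iff_lineAt (P := P)).2 ⟨h.max_lt_min, ?_, ?_⟩ <;>
    · rw [lineAt_eq_add_slope_mul γ _ x, lineAt_eq_add_slope_mul δ _ x, heq]
      nlinarith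

lemma noncrossing_iff {S : Set (PolygonSegment n)} : P.Noncrossing S ↔ NonCrossing up S := by
  refine ⟨fun h γ hγ δ hδ hc ↦ h γ hγ δ hδ (crossesUpward_iff.1 hc).1, fun h γ hγ δ hδ hc ↦ ?_⟩
  rcases hc.slope_ne.lt_or_gt with hs | hs
  · exact h γ hγ δ hδ (crossesUpward_iff.2 ⟨hc, hs⟩)
  · exact h δ hδ γ hγ (crossesUpward_iff.2 ⟨hc.symm, hs⟩)

end PolygonDrawing

/-! ### Flips -/

/-- The combinatorial form of the condition that the segments `(i, j)` and `(k, l)` cross: one of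
them crosses the other one upward. -/
def Crosses (U : Set ℕ) (i j k l : ℕ) : Prop :=
  CrossesUpward U i j k l ∨ CrossesUpward U k l i j

/- In the lemmas below `(i, j)` and `(k, l)` are the diagonals of a quadrilateral, with `(i, j)` the
one of smaller slope; `(k, j)` and `(i, l)` are its left and right sides. -/
section Quadrilateral

variable {U : Set ℕ} {i j k l a b : ℕ}

lemma crossesUpward_compl_iff : CrossesUpward Uᶜ k l i j ↔ CrossesUpward U i j k l := by
  simp only [CrossesUpward, Set.mem_compl_iff]
  grind

lemma crosses_compl_iff : Crosses Uᶜ i j k l ↔ Crosses U i j k l := by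
  rw [Crosses, crossesUpward_compl_iff, crossesUpward_compl_iff, or_comm, Crosses]

lemma Crosses.left_ne (h : Crosses U i j k l) : i ≠ k := by
  unfold Crosses CrossesUpward at h
  lia

lemma Crosses.right_ne (h : Crosses U i j k l) : j ≠ l := by
  unfold Crosses CrossesUpward at h
  lia

lemma CrossesUpward.crosses_of_crosses_left (h : CrossesUpward U i j k l)
    (hc : Crosses U a b k j) : Crosses U a b i j ∨ Crosses U a b k l := by
  unfold Crosses CrossesUpward at *
  simp only [max_lt_iff, lt_min_iff] at *
  rcases h with ⟨h, h' | h', h'' | h''⟩ <;>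
  rcases hc with ⟨g, g' | g', g'' | g''⟩ | ⟨g, g' | g', g'' | g''⟩ <;>
  grind (splits := 30)

lemma CrossesUpward.crosses_of_crosses_right (h : CrossesUpward U i j k l)
    (hc : Crosses U a b i l) : Crosses U a b i j ∨ Crosses U a b k l := by
  rw [← crosses_compl_iff] at hc
  simpa only [crosses_compl_iff] using
    ((crossesUpward_compl_iff.2 h).crosses_of_crosses_left hc).symm

lemma CrossesUpward.trans_or_side (h : CrossesUpward U i j k l) (hc : CrossesUpward U a b i j) :
    CrossesUpward U a b k l ∨ CrossesUpward U a b k j ∨ CrossesUpward U a b i l := by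
  unfold CrossesUpward at *
  grind

lemma CrossesUpward.side_of_pairwise (h : CrossesUpward U i j k l) (h₁ : CrossesUpward U i j a b)
    (h₂ : CrossesUpward U k l a b) : CrossesUpward U k j a b := by
  unfold CrossesUpward at *
  grind

end Quadrilateral

section Flip

variable {n : ℕ} {up : Fin (n + 1) → Bool} {S₁ S₂ S : Set (PolygonSegment n)}
  {γ₁ γ₂ δ : PolygonSegment n}

/-- The relation `Crosses` between the line segments of a polygon: one of them crosses the other
one upward. -/
def PolygonSegment.Crosses (up : Fin (n + 1) → Bool) (γ δ : PolygonSegment n) : Prop :=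
  γ.CrossesUpward up δ ∨ δ.CrossesUpward up γ

namespace PolygonSegment

lemma Crosses.symm (h : γ₁.Crosses up γ₂) : γ₂.Crosses up γ₁ :=
  Or.symm h

lemma Crosses.fst_ne (h : γ₁.Crosses up γ₂) : γ₁.1.1 ≠ γ₂.1.1 :=
  Fin.ne_of_val_ne (_root_.Crosses.left_ne h)

lemma Crosses.snd_ne (h : γ₁.Crosses up γ₂) : γ₁.1.2 ≠ γ₂.1.2 :=
  Fin.ne_of_val_ne (_root_.Crosses.right_ne h)

lemma Crosses.fst_lt_snd (h : γ₁.Crosses up γ₂) : γ₁.1.1 < γ₂.1.2 :=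
  Fin.lt_def.2 <| h.elim
    (fun h ↦ (max_lt_iff.1 h.1).1.trans_le (min_le_right _ _))
    fun h ↦ (max_lt_iff.1 h.1).2.trans_le (min_le_left _ _)

lemma CrossesUpward.crosses (h : γ₁.CrossesUpward up γ₂) : γ₁.Crosses up γ₂ :=
  Or.inl h

lemma not_crosses_self : ¬ δ.Crosses up δ :=
  fun h ↦ h.fst_ne rfl

lemma not_abutsUpward_of_fst_lt_snd (h₁ : γ₁.1.1 < γ₂.1.2) (h₂ : γ₂.1.1 < γ₁.1.2) :
    ¬ γ₁.AbutsUpward up γ₂ :=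
  fun h ↦ h.elim (fun h ↦ h₁.ne h.1) fun h ↦ h₂.ne h.1

end PolygonSegment

open PolygonSegment

lemma NonCrossing.not_crosses (hS : NonCrossing up S) (h₁ : γ₁ ∈ S) (h₂ : γ₂ ∈ S) :
    ¬ γ₁.Crosses up γ₂ :=
  fun h ↦ h.elim (hS _ h₁ _ h₂) (hS _ h₂ _ h₁)

lemma NonCrossing.mem_of_maximal (hS : Maximal (NonCrossing up) S)
    (h : ∀ γ ∈ S, ¬ γ.Crosses up δ) : δ ∈ S := by
  refine hS.2 (y := insert δ S) ?_ (Set.subset_insert _ _) (Set.mem_insert _ _)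
  rintro γ (rfl | hγ) ε (rfl | hε) hc
  · exact not_crosses_self hc.crosses
  · exact h ε hε hc.crosses.symm
  · exact h γ hγ hc.crosses
  · exact hS.1 γ hγ ε hε hc

lemma NonCrossing.crosses_of_sdiff_eq (h₁ : Maximal (NonCrossing up) S₁)
    (h₂ : Maximal (NonCrossing up) S₂) (hγ₂ : γ₂ ∈ S₂) (hne : γ₁ ≠ γ₂)
    (h : S₁ \ {γ₁} = S₂ \ {γ₂}) : γ₁.Crosses up γ₂ := by
  by_contra hc
  have hmem : γ₂ ∈ S₁ := by
    refine mem_of_maximal h₁ fun γ hγ ↦ ?_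
    by_cases hγ' : γ = γ₁
    · rwa [hγ']
    · exact h₂.1.not_crosses (h.le ⟨hγ, hγ'⟩).1 hγ₂
  exact (h.le ⟨hmem, hne.symm⟩).2 rfl

/-- The maximal noncrossing set `S₂` is a flip of `S₁`: it arises by replacing the segment `γ₁` by
a segment `γ₂` of larger slope which crosses `γ₁`. This is the covering relation of the Cambrian
lattice, with the slopes encoded by `CrossesUpward`. -/
structure IsFlip (up : Fin (n + 1) → Bool) (S₁ S₂ : Set (PolygonSegment n))
    (γ₁ γ₂ : PolygonSegment n) : Prop where
  maximal_left : Maximal (NonCrossing up) S₁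
  maximal_right : Maximal (NonCrossing up) S₂
  mem_left : γ₁ ∈ S₁
  mem_right : γ₂ ∈ S₂
  sdiff_eq : S₁ \ {γ₁} = S₂ \ {γ₂}
  crossesUpward : γ₁.CrossesUpward up γ₂

namespace IsFlip

lemma sdiff_subset (h : IsFlip up S₁ S₂ γ₁ γ₂) : S₁ \ {γ₁} ⊆ S₂ :=
  h.sdiff_eq ▸ Set.sdiff_subset

lemma ne (h : IsFlip up S₁ S₂ γ₁ γ₂) : S₁ ≠ S₂ := by
  rintro rfl
  exact h.maximal_left.1 _ h.mem_left _ h.mem_right h.crossesUpward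

lemma mem_sdiff_of_forall (h : IsFlip up S₁ S₂ γ₁ γ₂) (h₁ : ¬ δ.Crosses up γ₁) (hne : δ ≠ γ₁)
    (hδ : ∀ ε : PolygonSegment n, ε.Crosses up δ → ε.Crosses up γ₁ ∨ ε.Crosses up γ₂) :
    δ ∈ S₁ \ {γ₁} := by
  refine ⟨NonCrossing.mem_of_maximal h.maximal_left fun ε hε hc ↦ ?_, hne⟩
  by_cases hε' : ε = γ₁
  · exact h₁ (hε' ▸ hc.symm)
  · exact (hδ ε hc).elim (h.maximal_left.1.not_crosses hε h.mem_left)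
      (h.maximal_right.1.not_crosses (h.sdiff_subset ⟨hε, hε'⟩) h.mem_right)

lemma left_side_mem (h : IsFlip up S₁ S₂ γ₁ γ₂) :
    (⟨(γ₂.1.1, γ₁.1.2), h.crossesUpward.crosses.symm.fst_lt_snd⟩ : PolygonSegment n) ∈
      S₁ \ {γ₁} :=
  h.mem_sdiff_of_forall (fun hc ↦ hc.snd_ne rfl)
    (fun e ↦ h.crossesUpward.crosses.fst_ne (congrArg (fun σ : PolygonSegment n ↦ σ.1.1) e).symm)
    fun _ hc ↦ CrossesUpward.crosses_of_crosses_left h.crossesUpward hc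

lemma right_side_mem (h : IsFlip up S₁ S₂ γ₁ γ₂) :
    (⟨(γ₁.1.1, γ₂.1.2), h.crossesUpward.crosses.fst_lt_snd⟩ : PolygonSegment n) ∈ S₁ \ {γ₁} :=
  h.mem_sdiff_of_forall (fun hc ↦ hc.fst_ne rfl)
    (fun e ↦ h.crossesUpward.crosses.snd_ne (congrArg (fun σ : PolygonSegment n ↦ σ.1.2) e).symm)
    fun _ hc ↦ CrossesUpward.crosses_of_crosses_right h.crossesUpward hc

/-- This monotonicity along flips is what makes the order generated by flips antisymmetric. -/
lemma exists_crossesUpward (h : IsFlip up S₁ S₂ γ₁ γ₂) (hδ : ∃ γ ∈ S₁, δ.CrossesUpward up γ) :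
    ∃ γ ∈ S₂, δ.CrossesUpward up γ := by
  obtain ⟨γ, hγ, hc⟩ := hδ
  by_cases hγ' : γ = γ₁
  · subst hγ'
    rcases CrossesUpward.trans_or_side h.crossesUpward hc with hc | hc | hc
    · exact ⟨_, h.mem_right, hc⟩
    · exact ⟨_, h.sdiff_subset h.left_side_mem, hc⟩
    · exact ⟨_, h.sdiff_subset h.right_side_mem, hc⟩
  · exact ⟨γ, h.sdiff_subset ⟨hγ, hγ'⟩, hc⟩

lemma mem_or_exists_crossesUpward (h : IsFlip up S₁ S₂ γ₁ γ₂) (hδ : δ ∈ S₁) :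
    δ ∈ S₂ ∨ ∃ γ ∈ S₂, δ.CrossesUpward up γ := by
  by_cases hδ' : δ = γ₁
  · exact Or.inr ⟨γ₂, h.mem_right, hδ' ▸ h.crossesUpward⟩
  · exact Or.inl (h.sdiff_subset ⟨hδ, hδ'⟩)

lemma eq_of_left_eq {S₂' : Set (PolygonSegment n)} {γ₂' : PolygonSegment n}
    (h : IsFlip up S₁ S₂ γ₁ γ₂) (h' : IsFlip up S₁ S₂' γ₁ γ₂') : S₂' = S₂ := by
  have hS : S₂ \ {γ₂} = S₂' \ {γ₂'} := h.sdiff_eq.symm.trans h'.sdiff_eq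
  obtain rfl : γ₂ = γ₂' := by
    by_contra hne
    rcases NonCrossing.crosses_of_sdiff_eq h.maximal_right h'.maximal_right h'.mem_right
      hne hS with hc | hc
    · exact h'.maximal_right.1 _ (h'.sdiff_subset h.left_side_mem) _ h'.mem_right
        (CrossesUpward.side_of_pairwise h.crossesUpward h'.crossesUpward hc)
    · exact h.maximal_right.1 _ (h.sdiff_subset h'.left_side_mem) _ h.mem_right
        (CrossesUpward.side_of_pairwise h'.crossesUpward h.crossesUpward hc)
  rw [← Set.insert_sdiff_self_of_mem h'.mem_right, ← hS, Set.insert_sdiff_self_of_mem h.mem_right]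

end IsFlip

end Flip

namespace PolygonDrawing.Triangulation

variable {n : ℕ} {up : Fin (n + 1) → Bool} {P : PolygonDrawing up} {T₁ T₂ T : P.Triangulation}
  {δ : PolygonSegment n}

lemma maximal_noncrossing_iff {S : Set (PolygonSegment n)} :
    Maximal P.Noncrossing S ↔ Maximal (NonCrossing up) S := by
  rw [show P.Noncrossing = NonCrossing up from funext fun _ ↦ propext noncrossing_iff]

lemma coveredBy_iff : CoveredBy T₁ T₂ ↔ ∃ γ₁ γ₂, IsFlip up T₁.1 T₂.1 γ₁ γ₂ := by
  constructor
  · rintro ⟨γ₁, h₁, γ₂, h₂, hne, h, hs⟩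
    have hm₁ := maximal_noncrossing_iff.1 T₁.2
    have hm₂ := maximal_noncrossing_iff.1 T₂.2
    refine ⟨γ₁, γ₂, hm₁, hm₂, h₁, h₂, h, ?_⟩
    exact (NonCrossing.crosses_of_sdiff_eq hm₁ hm₂ h₂ hne h).resolve_right
      fun hc ↦ hs.not_gt ((crossesUpward_iff (P := P)).1 hc).2
  · rintro ⟨γ₁, γ₂, h⟩
    obtain ⟨hcross, hslope⟩ := (crossesUpward_iff (P := P)).1 h.crossesUpward
    exact ⟨γ₁, h.mem_left, γ₂, h.mem_right, hcross.1, h.sdiff_eq, hslope⟩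

lemma exists_crossesUpward_of_le (h : T₁ ≤ T₂) (hδ : ∃ γ ∈ T₁.1, δ.CrossesUpward up γ) :
    ∃ γ ∈ T₂.1, δ.CrossesUpward up γ := by
  induction h with
  | refl => exact hδ
  | tail _ h ih =>
    obtain ⟨γ₁, γ₂, h⟩ := coveredBy_iff.1 h
    exact h.exists_crossesUpward ih

lemma mem_or_exists_crossesUpward_of_le (h : T₁ ≤ T₂) (hδ : δ ∈ T₁.1) :
    δ ∈ T₂.1 ∨ ∃ γ ∈ T₂.1, δ.CrossesUpward up γ := by
  induction h with
  | refl => exact Or.inl hδ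
  | tail _ h ih =>
    obtain ⟨γ₁, γ₂, h⟩ := coveredBy_iff.1 h
    exact ih.elim h.mem_or_exists_crossesUpward fun ih ↦ Or.inr (h.exists_crossesUpward ih)

lemma mem_of_le_of_le (h₁ : T₁ ≤ T) (h₂ : T ≤ T₂) (hδ₁ : δ ∈ T₁.1) (hδ₂ : δ ∈ T₂.1) :
    δ ∈ T.1 := by
  refine (mem_or_exists_crossesUpward_of_le h₁ hδ₁).resolve_right fun h ↦ ?_
  obtain ⟨γ, hγ, hc⟩ := exists_crossesUpward_of_le h₂ h
  exact (maximal_noncrossing_iff.1 T₂.2).1 _ hδ₂ _ hγ hc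

lemma le_antisymm (h₁ : T₁ ≤ T₂) (h₂ : T₂ ≤ T₁) : T₁ = T₂ := by
  have h : T₁.1 ⊆ T₂.1 := fun δ hδ ↦ mem_of_le_of_le h₁ h₂ hδ hδ
  exact Subtype.ext (h.antisymm (T₁.2.2 T₂.2.1 h))

lemma covBy_of_coveredBy (h : CoveredBy T₁ T₂) : T₁ ⋖ T₂ := by
  obtain ⟨γ₁, γ₂, hf⟩ := coveredBy_iff.1 h
  have hle : T₁ ≤ T₂ := Relation.ReflTransGen.single h
  refine ⟨lt_of_le_not_ge hle fun h' ↦ hf.ne (congrArg Subtype.val (le_antisymm hle h')),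
    fun T hT₁ hT₂ ↦ ?_⟩
  rcases Relation.ReflTransGen.cases_head hT₁.le with rfl | ⟨T', hT', hTT⟩
  · exact hT₁.false
  obtain ⟨γ, γ', hf'⟩ := coveredBy_iff.1 hT'
  -- Every segment of `T₁` other than `γ₁` lies in `T₂`, hence in `T'`, so the first flip on the way
  -- from `T₁` to `T` already removes `γ₁`.
  have hγ : γ = γ₁ := by
    by_contra hne
    have hmem : γ ∈ T'.1 := mem_of_le_of_le (Relation.ReflTransGen.single hT')
      (le_trans (b := T) hTT hT₂.le) hf'.mem_left (hf.sdiff_subset ⟨hf'.mem_left, hne⟩)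
    exact hf'.maximal_right.1 _ hmem _ hf'.mem_right hf'.crossesUpward
  subst hγ
  obtain rfl : T' = T₂ := Subtype.ext (hf.eq_of_left_eq hf')
  exact hT₂.not_ge hTT

end PolygonDrawing.Triangulation

lemma rel_of_covBy_of_le_iff_reflTransGen {α : Type*} [Preorder α] {r : α → α → Prop}
    (hle : ∀ a b : α, a ≤ b ↔ Relation.ReflTransGen r a b) (hr : ∀ a b, r a b → a < b) {a b : α}
    (h : a ⋖ b) : r a b := by
  rcases Relation.ReflTransGen.cases_head ((hle a b).1 h.le) with rfl | ⟨c, hac, hcb⟩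
  · exact absurd h.lt (lt_irrefl _)
  rcases Relation.ReflTransGen.cases_head hcb with rfl | ⟨d, hcd, hdb⟩
  · exact hac
  · exact absurd ((hr c d hcd).trans_le ((hle d b).2 hdb)) (h.2 (hr a c hac))

/-! ### The isomorphism with the Cambrian lattice -/

namespace TypeARep

variable {k : Type u} [Field k] {n : ℕ} {up : Fin (n + 1) → Bool}
  {T T₁ T₂ M M₁ M₂ R E : TypeARep k up} {γ γ₁ γ₂ : PolygonSegment n}

open PolygonSegment

lemma crossesUpward_or_abutsUpward_of_shortExact (e₁ : M₁ ≅ segmentRep k up γ₁)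
    (e₂ : M₂ ≅ segmentRep k up γ₂) {f : M₁ ⟶ E} {g : E ⟶ M₂} {w : f ≫ g = 0}
    (hS : (ShortComplex.mk f g w).ShortExact)
    (hsplit : IsEmpty (ShortComplex.mk f g w).Splitting) :
    γ₁.CrossesUpward up γ₂ ∨ γ₁.AbutsUpward up γ₂ := by
  by_contra! h
  have := subsingleton_ext_segmentRep (k := k) h.1 h.2
  have := subsingleton_ext_of_iso e₂ e₁ 1
  exact hsplit.elim (nonempty_splitting_of_subsingleton_ext hS).some

lemma mem_segments_and_sdiff_eq_of_iso_biprod (hT : IsBasic T) (e : T ≅ M ⊞ R)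
    (e' : M ≅ segmentRep k up γ) : γ ∈ segments T ∧ segments T \ {γ} = segments R := by
  have hM : segments M = {γ} := by rw [segments_eq_of_iso e', segments_segmentRep]
  have hγ : γ ∉ segments R := by
    have := (hT.of_isSummand (IsSummand.of_iso e.symm)).disjoint_segments
    rwa [hM, Set.disjoint_singleton_left] at this
  rw [segments_eq_of_iso e, segments_biprod, hM, Set.singleton_union]
  exact ⟨Set.mem_insert _ _, Set.insert_sdiff_self_of_notMem hγ⟩

lemma exists_isFlip_of_coveredBy (h₁ : IsMaximalAlmostRigid T₁) (h₂ : IsMaximalAlmostRigid T₂)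
    (h : CoveredBy T₁ T₂) : ∃ γ₁ γ₂, IsFlip up (segments T₁) (segments T₂) γ₁ γ₂ := by
  obtain ⟨hb₁, hm₁⟩ := isMaximalAlmostRigid_iff.1 h₁
  obtain ⟨hb₂, hm₂⟩ := isMaximalAlmostRigid_iff.1 h₂
  obtain ⟨M₁, M₂, R, E, E', hM₁, hM₂, ⟨e₁⟩, ⟨e₂⟩, -, -, -, -, f, g, w, hS, hsplit⟩ := h
  obtain ⟨γ₁, ⟨i₁⟩⟩ := exists_iso_segmentRep hM₁
  obtain ⟨γ₂, ⟨i₂⟩⟩ := exists_iso_segmentRep hM₂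
  obtain ⟨hγ₁, hR₁⟩ := mem_segments_and_sdiff_eq_of_iso_biprod hb₁ e₁ i₁
  obtain ⟨hγ₂, hR₂⟩ := mem_segments_and_sdiff_eq_of_iso_biprod hb₂ e₂ i₂
  have hR := hR₁.trans hR₂.symm
  have hext := crossesUpward_or_abutsUpward_of_shortExact i₁ i₂ hS hsplit
  have hne : γ₁ ≠ γ₂ := by
    rintro rfl
    exact hext.elim (fun h ↦ not_crosses_self h.crosses) (not_abutsUpward_of_fst_lt_snd γ₁.2 γ₁.2)
  have hc := NonCrossing.crosses_of_sdiff_eq hm₁ hm₂ hγ₂ hne hR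
  exact ⟨γ₁, γ₂, hm₁, hm₂, hγ₁, hγ₂, hR, hext.resolve_right
    (not_abutsUpward_of_fst_lt_snd hc.fst_lt_snd hc.symm.fst_lt_snd)⟩

lemma coveredBy_of_isFlip (h₁ : IsBasic T₁) (h₂ : IsBasic T₂)
    (h : IsFlip up (segments T₁) (segments T₂) γ₁ γ₂) : CoveredBy T₁ T₂ := by
  obtain ⟨R, ⟨e₁⟩, hbR, hR⟩ := exists_iso_biprod_of_mem_segments h₁ h.mem_left
  obtain ⟨R', ⟨e₂⟩, hbR', hR'⟩ := exists_iso_biprod_of_mem_segments h₂ h.mem_right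
  obtain ⟨e⟩ := nonempty_iso_of_segments_eq hbR' hbR (by rw [hR, hR', h.sdiff_eq])
  exact ⟨_, _, R, _, _, indecomposable_segmentRep γ₁, indecomposable_segmentRep γ₂, ⟨e₁⟩,
    ⟨e₂ ≪≫ biprod.mapIso (Iso.refl _) e⟩, indecomposable_segmentRep _,
    indecomposable_segmentRep _, hR.ge h.left_side_mem, hR.ge h.right_side_mem,
    exists_shortExact_of_crossesUpward h.crossesUpward _ _⟩

end TypeARep

namespace Mar

variable {k : Type u} [Field k] {n : ℕ} {up : Fin (n + 1) → Bool} {t₁ t₂ : Mar k up}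

open PolygonDrawing TypeARep

/-- The triangulation which consists of the line segments of the indecomposable summands of a
maximal almost rigid representation. -/
def triangulation (P : PolygonDrawing up) : Mar k up → P.Triangulation :=
  Quotient.lift (fun T ↦ ⟨segments T.1,
    Triangulation.maximal_noncrossing_iff.2 (isMaximalAlmostRigid_iff.1 T.2).2⟩)
    fun _ _ ⟨e⟩ ↦ Subtype.ext (segments_eq_of_iso e)

lemma exists_eq_mk (t : Mar k up) : ∃ T hT, t = mk T hT := by
  obtain ⟨⟨T, hT⟩, rfl⟩ := Quotient.exists_rep t
  exact ⟨T, hT, rfl⟩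

lemma triangulation_bijective (P : PolygonDrawing up) :
    Function.Bijective (triangulation P : Mar k up → P.Triangulation) := by
  constructor
  · intro t₁ t₂ h
    obtain ⟨T₁, h₁, rfl⟩ := exists_eq_mk t₁
    obtain ⟨T₂, h₂, rfl⟩ := exists_eq_mk t₂
    exact Quotient.sound (nonempty_iso_of_segments_eq (isMaximalAlmostRigid_iff.1 h₁).1
      (isMaximalAlmostRigid_iff.1 h₂).1 (congrArg Subtype.val h))
  · rintro ⟨S, hS⟩
    obtain ⟨T, hb, rfl⟩ := exists_isBasic_segments_eq k up S
    exact ⟨mk T (isMaximalAlmostRigid_iff.2 ⟨hb, Triangulation.maximal_noncrossing_iff.1 hS⟩), rfl⟩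

lemma coveredBy_triangulation_iff (P : PolygonDrawing up) :
    (triangulation P t₁).CoveredBy (triangulation P t₂) ↔ CoveredBy t₁ t₂ := by
  rw [Triangulation.coveredBy_iff]
  constructor
  · rintro ⟨γ₁, γ₂, h⟩
    obtain ⟨T₁, h₁, rfl⟩ := exists_eq_mk t₁
    obtain ⟨T₂, h₂, rfl⟩ := exists_eq_mk t₂
    exact ⟨T₁, T₂, h₁, h₂, rfl, rfl, coveredBy_of_isFlip (isMaximalAlmostRigid_iff.1 h₁).1
      (isMaximalAlmostRigid_iff.1 h₂).1 h⟩
  · rintro ⟨T₁, T₂, h₁, h₂, rfl, rfl, h⟩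
    exact exists_isFlip_of_coveredBy h₁ h₂ h

/-- The isomorphism of `mar(Q)` with the Cambrian lattice. -/
noncomputable def triangulationOrderIso (P : PolygonDrawing up) : Mar k up ≃o P.Triangulation where
  toEquiv := Equiv.ofBijective _ (triangulation_bijective P)
  map_rel_iff' {t₁ t₂} := by
    let e := Equiv.ofBijective (triangulation (k := k) P) (triangulation_bijective P)
    have he : ∀ a b, (e a).CoveredBy (e b) ↔ CoveredBy a b :=
      fun _ _ ↦ coveredBy_triangulation_iff P
    refine ⟨fun h ↦ ?_, fun h ↦ Relation.ReflTransGen.lift e (fun a b ↦ (he a b).2) t₁ t₂ h⟩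
    have := Relation.ReflTransGen.lift (p := CoveredBy) e.symm
      (fun a b hab ↦ (he _ _).1 (by simpa only [Equiv.apply_symm_apply] using hab)) (e t₁) (e t₂) h
    rwa [Function.onFun, Equiv.symm_apply_apply, Equiv.symm_apply_apply] at this

end Mar

theorem theorem4 (k : Type u) [Field k] (n : ℕ) (up : Fin (n + 1) → Bool)
    (P : PolygonDrawing up) :
    (∀ t₁ t₂ : Mar k up, t₁ ≤ t₂ → t₂ ≤ t₁ → t₁ = t₂) ∧
    (∀ t₁ t₂ : Mar k up, t₁ ⋖ t₂ ↔ Mar.CoveredBy t₁ t₂) ∧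
    Nonempty (Mar k up ≃o P.Triangulation) := by
  let Φ : Mar k up ≃o P.Triangulation := Mar.triangulationOrderIso P
  have covBy_of_coveredBy : ∀ t₁ t₂ : Mar k up, Mar.CoveredBy t₁ t₂ → t₁ ⋖ t₂ := fun t₁ t₂ h ↦
    (apply_covBy_apply_iff Φ).1 <| PolygonDrawing.Triangulation.covBy_of_coveredBy
      ((Mar.coveredBy_triangulation_iff P).2 h)
  refine ⟨fun t₁ t₂ h h' ↦ Φ.injective ?_, fun t₁ t₂ ↦ ⟨fun h ↦ ?_, covBy_of_coveredBy t₁ t₂⟩, ⟨Φ⟩⟩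
  · exact PolygonDrawing.Triangulation.le_antisymm (Φ.map_rel_iff.2 h) (Φ.map_rel_iff.2 h')
  · exact rel_of_covBy_of_le_iff_reflTransGen (fun _ _ ↦ Iff.rfl)
      (fun a b h ↦ (covBy_of_coveredBy a b h).lt) h
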